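/- Let $H$ be a separable (real or complex) Hilbert space with norm $\|\cdot\|$, and let $A:D(A)\subset H\to H$ be a self-adjoint operator that is coercive (there is $c>0$ with $\langle Au,u\rangle\ge c\|u\|^2$ for all $u\in D(A)$), has compact resolvent and has simple spectrum (every eigenvalue of $A$ has multiplicity one). Let $\alpha\in\mathbb{R}$, $\alpha\neq 0$. Consider the system $$u_{tt}+Au+u_t+\alpha y_t=0,\qquad y_{tt}+Ay-\alpha u_t=0 .$$ Let $\mathcal H=D(A^{1/2})\times H\times D(A^{1/2})\times H$ be the energy space with the norm $$\|(u,v,y,z)\|_{\mathcal H}^2=\|A^{1/2}u\|^2+\|v\|^2+\|A^{1/2}y\|^2+\|z\|^2,$$ and let $\mathcal A$ be the operator in $\mathcal H$ with domain $$D(\mathcal A)=\{(u,v,y,z)\in\mathcal H:\ u,y\in D(A),\ v,z\in D(A^{1/2})\}$$ given by $\mathcal A(u,v,y,z)=(v,\,-Au-v-\alpha z,\,z,\,-Ay+\alpha v)$, so that the system reads $U_t=\mathcal A U$ with $U=(u,u_t,y,y_t)$. Then $\mathcal A$ generates a $C_0$-semigroup of contractions $(e^{t\mathcal A})_{t\ge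 0}$ on $\mathcal H$, and this semigroup is exponentially stable: there are constants $M>0$ and $\varepsilon>0$ such that $$\|e^{t\mathcal A}U_0\|_{\mathcal H}\le M e^{-\varepsilon t}\|U_0\|_{\mathcal H}\qquad\text{for all } t>0 \text{ and all } U_0\in\mathcal H .$$ -/

import Mathlib

open Filter Topology
open scoped NNReal InnerProductSpace

noncomputable section

/-! ### Unbounded operators on a Hilbert space -/

section Operators

variable {𝕜 H : Type*} [RCLike 𝕜] [NormedAddCommGroup H] [InnerProductSpace 𝕜 H]

/-- `e` is an eigenvector (or zero) of the unbounded operator `A` for the real number `l`: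
`e ∈ D(A)` and `A e = l e`. -/
def IsEigenpair (A : H →ₗ.[𝕜] H) (l : ℝ) (e : H) : Prop :=
  ∃ he : e ∈ A.domain, A ⟨e, he⟩ = (l : 𝕜) • e

/-- `A` is coercive: `⟨A u, u⟩ ≥ c ‖u‖²` on `D(A)` for some `c > 0`. -/
def IsCoerciveOperator (A : H →ₗ.[𝕜] H) : Prop :=
  ∃ c : ℝ, 0 < c ∧ ∀ u : A.domain, c * ‖(u : H)‖ ^ 2 ≤ RCLike.re ⟪A u, (u : H)⟫_𝕜

/-- `A` has compact resolvent: for some scalar `z`, the operator `z - A : D(A) → H` is bijective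
and its inverse is a compact operator on `H`. -/
def HasCompactResolvent (A : H →ₗ.[𝕜] H) : Prop :=
  ∃ (z : 𝕜) (R : H →L[𝕜] H), IsCompactOperator R ∧
    (∀ x : H, ∃ h : R x ∈ A.domain, z • R x - A ⟨R x, h⟩ = x) ∧
    (∀ u : A.domain, R (z • (u : H) - A u) = u)

/-- The spectrum of `A` is simple: eigenvectors for one and the same eigenvalue are collinear.
(This is for self-adjoint operators with compact resolvent, whose spectrum consists of real
eigenvalues.) -/
def HasSimpleSpectrum (A : H →ₗ.[𝕜] H) : Prop :=
  ∀ (l : ℝ) (e f : H), IsEigenpair A l e → IsEigenpair A l f → e ≠ 0 → ∃ k : 𝕜, f = k • e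

/-- The graph of the power `A ^ s`, defined spectrally: `A ^ s u = w` means that
`⟨e, w⟩ = l ^ s ⟨e, u⟩` for every eigenvector `e` of `A`, with eigenvalue `l`.
When `A` has a Hilbert basis of eigenvectors `A e_n = l_n e_n`, with `l_n > 0`, this says
`u = ∑ u_n e_n`, `w = ∑ l_n ^ s u_n e_n`; such a `w ∈ H` exists if and only if
`∑ l_n ^ (2 s) |u_n| ^ 2 < ∞`, and it is then unique. -/
def fracPowGraph (A : H →ₗ.[𝕜] H) (s : ℝ) : Submodule 𝕜 (H × H) where
  carrier := {p | ∀ (l : ℝ) (e : H), IsEigenpair A l e →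
    ⟪e, p.2⟫_𝕜 = ((l ^ s : ℝ) : 𝕜) * ⟪e, p.1⟫_𝕜}
  add_mem' := by
    intro p q hp hq l e he
    simp only [Prod.fst_add, Prod.snd_add, inner_add_right, hp l e he, hq l e he, mul_add]
  zero_mem' := by
    intro l e _
    simp
  smul_mem' := by
    intro k p hp l e he
    simp only [Prod.smul_fst, Prod.smul_snd, inner_smul_right, hp l e he]
    ring

/-- The power `A ^ s` of `A` as an unbounded operator. -/
def fracPow (A : H →ₗ.[𝕜] H) (s : ℝ) : H →ₗ.[𝕜] H :=
  (fracPowGraph A s).toLinearPMap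

/-- The square root `A ^ (1/2)`. -/
abbrev sqrtOp (A : H →ₗ.[𝕜] H) : H →ₗ.[𝕜] H := fracPow A (1 / 2)

/-! ### The energy space -/

/-- The energy space `D(A ^ (1/2)) × H × D(A ^ (1/2)) × H`. -/
def EnergySpace (A : H →ₗ.[𝕜] H) : Type _ :=
  (sqrtOp A).domain × H × (sqrtOp A).domain × H

namespace EnergySpace

variable (A : H →ₗ.[𝕜] H)

instance : AddCommGroup (EnergySpace A) :=
  inferInstanceAs (AddCommGroup ((sqrtOp A).domain × H × (sqrtOp A).domain × H))

instance : Module 𝕜 (EnergySpace A) :=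
  inferInstanceAs (Module 𝕜 ((sqrtOp A).domain × H × (sqrtOp A).domain × H))

variable {A}

/-- The element `(u, v, y, z)` of the energy space. -/
def mk (u : (sqrtOp A).domain) (v : H) (y : (sqrtOp A).domain) (z : H) : EnergySpace A :=
  (u, v, y, z)

/-- The component `u` of `(u, v, y, z)`. -/
def u (U : EnergySpace A) : (sqrtOp A).domain := U.1

/-- The component `v` of `(u, v, y, z)`. -/
def v (U : EnergySpace A) : H := U.2.1

/-- The component `y` of `(u, v, y, z)`. -/
def y (U : EnergySpace A) : (sqrtOp A).domain := U.2.2.1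

/-- The component `z` of `(u, v, y, z)`. -/
def z (U : EnergySpace A) : H := U.2.2.2

variable (A)

/-- The map `(u, v, y, z) ↦ (A ^ (1/2) u, v, A ^ (1/2) y, z)` into the Hilbert sum of four copies
of `H`; the energy norm is the norm of the image. -/
def toHilbertSum : EnergySpace A →ₗ[𝕜] PiLp 2 (fun _ : Fin 4 => H) where
  toFun U := WithLp.toLp 2 ![sqrtOp A U.u, U.v, sqrtOp A U.y, U.z]
  map_add' U W := by
    ext i
    fin_cases i
    · exact (sqrtOp A).map_add U.u W.u
    · rfl
    · exact (sqrtOp A).map_add U.y W.y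
    · rfl
  map_smul' k U := by
    ext i
    fin_cases i
    · exact (sqrtOp A).map_smul k U.u
    · rfl
    · exact (sqrtOp A).map_smul k U.y
    · rfl

/-- The energy norm `‖(u, v, y, z)‖² = ‖A^(1/2) u‖² + ‖v‖² + ‖A^(1/2) y‖² + ‖z‖²`
(see `EnergySpace.norm_sq`). It is a norm whenever `A ^ (1/2)` is injective, in particular for
coercive self-adjoint `A` with compact resolvent. -/
instance : SeminormedAddCommGroup (EnergySpace A) :=
  SeminormedAddCommGroup.induced (EnergySpace A) (PiLp 2 (fun _ : Fin 4 => H)) (toHilbertSum A)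

instance : NormedSpace 𝕜 (EnergySpace A) :=
  NormedSpace.induced 𝕜 (EnergySpace A) (PiLp 2 (fun _ : Fin 4 => H)) (toHilbertSum A)

theorem norm_sq (U : EnergySpace A) :
    ‖U‖ ^ 2 = ‖sqrtOp A U.u‖ ^ 2 + ‖U.v‖ ^ 2 + ‖sqrtOp A U.y‖ ^ 2 + ‖U.z‖ ^ 2 := by
  change ‖toHilbertSum A U‖ ^ 2 = _
  rw [PiLp.norm_sq_eq_of_L2, Fin.sum_univ_four]
  rfl

end EnergySpace

/-- The operator of the first order form `U_t = 𝒜 U` of the system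
`u_tt + A u + u_t + α y_t = 0`, `y_tt + A y - α u_t = 0`, where `U = (u, v, y, z)`,
`v = u_t`, `z = y_t`: its domain is given by `u, y ∈ D(A)` and `v, z ∈ D(A ^ (1/2))`, and
`𝒜 (u, v, y, z) = (v, - A u - v - α z, z, - A y + α v)`. -/
def coupledOperator (A : H →ₗ.[𝕜] H) (α : ℝ) : EnergySpace A →ₗ.[𝕜] EnergySpace A where
  domain :=
    { carrier := {U | (U.u : H) ∈ A.domain ∧ U.v ∈ (sqrtOp A).domain ∧
        (U.y : H) ∈ A.domain ∧ U.z ∈ (sqrtOp A).domain}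
      add_mem' := fun hU hW =>
        ⟨A.domain.add_mem hU.1 hW.1, (sqrtOp A).domain.add_mem hU.2.1 hW.2.1,
          A.domain.add_mem hU.2.2.1 hW.2.2.1, (sqrtOp A).domain.add_mem hU.2.2.2 hW.2.2.2⟩
      zero_mem' :=
        ⟨A.domain.zero_mem, (sqrtOp A).domain.zero_mem,
          A.domain.zero_mem, (sqrtOp A).domain.zero_mem⟩
      smul_mem' := fun k _ hU =>
        ⟨A.domain.smul_mem k hU.1, (sqrtOp A).domain.smul_mem k hU.2.1,
          A.domain.smul_mem k hU.2.2.1, (sqrtOp A).domain.smul_mem k hU.2.2.2⟩ }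
  toFun :=
    { toFun := fun U => EnergySpace.mk
        ⟨U.1.v, U.2.2.1⟩
        (-A ⟨(U.1.u : H), U.2.1⟩ - U.1.v - (α : 𝕜) • U.1.z)
        ⟨U.1.z, U.2.2.2.2⟩
        (-A ⟨(U.1.y : H), U.2.2.2.1⟩ + (α : 𝕜) • U.1.v)
      map_add' := by
        rintro ⟨U, hU⟩ ⟨W, hW⟩
        have h1 : A ⟨((U + W).u : H), A.domain.add_mem hU.1 hW.1⟩
            = A ⟨(U.u : H), hU.1⟩ + A ⟨(W.u : H), hW.1⟩ :=
          A.map_add ⟨(U.u : H), hU.1⟩ ⟨(W.u : H), hW.1⟩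
        have h2 : A ⟨((U + W).y : H), A.domain.add_mem hU.2.2.1 hW.2.2.1⟩
            = A ⟨(U.y : H), hU.2.2.1⟩ + A ⟨(W.y : H), hW.2.2.1⟩ :=
          A.map_add ⟨(U.y : H), hU.2.2.1⟩ ⟨(W.y : H), hW.2.2.1⟩
        have h3 : (U + W).v = U.v + W.v := rfl
        have h4 : (U + W).z = U.z + W.z := rfl
        refine Prod.ext rfl (Prod.ext ?_ (Prod.ext rfl ?_))
        · change -A ⟨((U + W).u : H), _⟩ - (U + W).v - (α : 𝕜) • (U + W).z
            = (-A ⟨(U.u : H), _⟩ - U.v - (α : 𝕜) • U.z)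
              + (-A ⟨(W.u : H), _⟩ - W.v - (α : 𝕜) • W.z)
          rw [h1, h3, h4, smul_add]
          abel
        · change -A ⟨((U + W).y : H), _⟩ + (α : 𝕜) • (U + W).v
            = (-A ⟨(U.y : H), _⟩ + (α : 𝕜) • U.v) + (-A ⟨(W.y : H), _⟩ + (α : 𝕜) • W.v)
          rw [h2, h3, smul_add]
          abel
      map_smul' := by
        rintro k ⟨U, hU⟩
        have h1 : A ⟨((k • U).u : H), A.domain.smul_mem k hU.1⟩ = k • A ⟨(U.u : H), hU.1⟩ :=
          A.map_smul k ⟨(U.u : H), hU.1⟩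
        have h2 : A ⟨((k • U).y : H), A.domain.smul_mem k hU.2.2.1⟩
            = k • A ⟨(U.y : H), hU.2.2.1⟩ :=
          A.map_smul k ⟨(U.y : H), hU.2.2.1⟩
        have h3 : (k • U).v = k • U.v := rfl
        have h4 : (k • U).z = k • U.z := rfl
        refine Prod.ext rfl (Prod.ext ?_ (Prod.ext rfl ?_))
        · change -A ⟨((k • U).u : H), _⟩ - (k • U).v - (α : 𝕜) • (k • U).z
            = k • (-A ⟨(U.u : H), _⟩ - U.v - (α : 𝕜) • U.z)
          rw [h1, h3, h4, smul_sub, smul_sub, smul_neg, smul_comm]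
        · change -A ⟨((k • U).y : H), _⟩ + (α : 𝕜) • (k • U).v
            = k • (-A ⟨(U.y : H), _⟩ + (α : 𝕜) • U.v)
          rw [h2, h3, smul_add, smul_neg, smul_comm] }

end Operators

/-! ### Strongly continuous semigroups -/

section Semigroups

variable (𝕜 X : Type*) [RCLike 𝕜] [SeminormedAddCommGroup X] [NormedSpace 𝕜 X]

/-- A `C₀`-semigroup of contractions on `X`. -/
structure ContractionC0Semigroup where
  /-- The operator `S(t)` of the semigroup. -/
  op : ℝ≥0 → X →L[𝕜] X
  op_zero : op 0 = ContinuousLinearMap.id 𝕜 X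
  op_add : ∀ s t : ℝ≥0, op (s + t) = (op s).comp (op t)
  tendsto_zero : ∀ x : X, Tendsto (fun t : ℝ≥0 => op t x) (𝓝[>] 0) (𝓝 x)
  norm_op_le : ∀ (t : ℝ≥0) (x : X), ‖op t x‖ ≤ ‖x‖

variable {𝕜 X}

namespace ContractionC0Semigroup

/-- The operator `B` is the infinitesimal generator of `S`: `x ∈ D(B)` and `B x = w` if and only if
`(S(t) x - x) / t → w` as `t → 0+`. -/
def IsGeneratedBy (S : ContractionC0Semigroup 𝕜 X) (B : X →ₗ.[𝕜] X) : Prop :=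
  ∀ x w : X, (∃ hx : x ∈ B.domain, B ⟨x, hx⟩ = w) ↔
    Tendsto (fun t : ℝ≥0 => (((t : ℝ)⁻¹ : ℝ) : 𝕜) • (S.op t x - x)) (𝓝[>] 0) (𝓝 w)

/-- Exponential stability: `‖S(t) x‖ ≤ M e^(-ε t) ‖x‖` for all `t > 0` and all `x`, for some
constants `M, ε > 0`. -/
def IsExponentiallyStable (S : ContractionC0Semigroup 𝕜 X) : Prop :=
  ∃ M ε : ℝ, 0 < M ∧ 0 < ε ∧ ∀ t : ℝ≥0, 0 < t → ∀ x : X,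
    ‖S.op t x‖ ≤ M * Real.exp (-ε * t) * ‖x‖

end ContractionC0Semigroup

end Semigroups

end

/-!
Why the theorem is true. A coercive self-adjoint operator `A` is onto, and its inverse is compact
when `A` has compact resolvent; the spectral theorem for the inverse gives a Hilbert basis `b i`
of eigenvectors of `A`, with eigenvalues `l i ≥ c > 0` (`exists_hilbertBasis_isEigenpair`). In
this basis `A` and `A ^ (1/2)` are multiplication operators with maximal domain, and the energy
space is the `ℓ²` sum of four-dimensional spaces with coordinates `(√l u, v, √l y, z)`
(`EnergySpace.coord`).

Generation. In these coordinates the coupled operator is block diagonal with maximal domain, with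
dissipative blocks `M i` (`exists_coupledOperator_apply_eq_iff`, `re_inner_modeBlock_nonpos`). The
blockwise exponentials `exp (t M i)` are contractions, and dominated convergence in `ℓ²` shows
that they form a `C₀`-semigroup generated by the block diagonal operator
(`exists_diagonal_semigroup`).

Stability. The energy `E`, half the squared norm, only satisfies `E' = -‖v‖²` along a solution.
The two correction terms
`Re ⟪v, z⟫ + Re ⟪A ^ (1/2) u, A ^ (1/2) y⟫` and `Re ⟪u, v⟫ + Re ⟪y, z⟫` repair this. In the
derivative of the first one the unbounded terms `⟪A u, z⟫` and `⟪A y, v⟫` cancel, and `-α ‖z‖²`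
remains, which is negative after multiplication by the sign of `α`: this is how the coupling
through the velocities transfers the damping to the second equation. The second one contributes
`-‖A ^ (1/2) u‖² - ‖A ^ (1/2) y‖²`. With small weights, the sum `V` of the energy and these terms
is comparable to the energy and satisfies `V' ≤ -m V` (`exists_lyapunov_weights`,
`hasDerivWithinAt_lyapunov`). This applies to every semigroup generated by the coupled operator,
since its trajectories starting in the domain of the generator are right differentiable; the
estimate extends to all initial data by density (`coupledOperator_dense_domain`).
-/

/-! ### Self-adjoint operators with compact resolvent -/

section Spectral

variable {𝕜 H : Type*} [RCLike 𝕜] [NormedAddCommGroup H] [InnerProductSpace 𝕜 H]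

theorem IsSelfAdjoint.inner_apply_left [CompleteSpace H] {A : H →ₗ.[𝕜] H} (hA : IsSelfAdjoint A)
    (u v : A.domain) : ⟪A u, (v : H)⟫_𝕜 = ⟪(u : H), A v⟫_𝕜 := by
  have h := LinearPMap.adjoint_isFormalAdjoint hA.dense_domain
  rw [LinearPMap.isSelfAdjoint_def.1 hA] at h
  exact h u v

/-- The domain of a self-adjoint operator is maximal: it suffices to test `A u = w` weakly. -/
theorem IsSelfAdjoint.exists_apply_eq_of_inner_eq [CompleteSpace H] {A : H →ₗ.[𝕜] H}
    (hA : IsSelfAdjoint A) {u w : H} (h : ∀ v : A.domain, ⟪w, (v : H)⟫_𝕜 = ⟪u, A v⟫_𝕜) :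
    ∃ hu : u ∈ A.domain, A ⟨u, hu⟩ = w := by
  have hmem := LinearPMap.mem_adjoint_domain_of_exists u ⟨w, h⟩
  have hz := LinearPMap.adjoint_apply_eq hA.dense_domain ⟨u, hmem⟩ h
  have hg : (u, w) ∈ A.adjoint.graph := (LinearPMap.mem_graph_iff _).2 ⟨⟨u, hmem⟩, rfl, hz⟩
  rw [LinearPMap.isSelfAdjoint_def.1 hA] at hg
  obtain ⟨v, hv1, hv2⟩ := (LinearPMap.mem_graph_iff _).1 hg
  dsimp at hv1 hv2
  subst hv1
  exact ⟨v.2, hv2⟩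

theorem LinearPMap.coercive_bound {A : H →ₗ.[𝕜] H} {c : ℝ}
    (hc : ∀ u : A.domain, c * ‖(u : H)‖ ^ 2 ≤ RCLike.re ⟪A u, (u : H)⟫_𝕜) (u : A.domain) :
    c * ‖(u : H)‖ ≤ ‖A u‖ := by
  rcases eq_or_ne (u : H) 0 with h | h
  · simp [h]
  · have h1 := (hc u).trans (re_inner_le_norm (𝕜 := 𝕜) (A u) (u : H))
    have : 0 < ‖(u : H)‖ := norm_pos_iff.2 h
    nlinarith

/-- A coercive self-adjoint operator is onto: its range is closed because the operator is closed and
bounded below, and the orthogonal complement of the range is the kernel. -/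
theorem IsSelfAdjoint.surjective_of_coercive [CompleteSpace H] {A : H →ₗ.[𝕜] H}
    (hA : IsSelfAdjoint A) {c : ℝ} (hc0 : 0 < c)
    (hc : ∀ u : A.domain, c * ‖(u : H)‖ ^ 2 ≤ RCLike.re ⟪A u, (u : H)⟫_𝕜) (f : H) :
    ∃ u : A.domain, A u = f := by
  -- the projection of the graph onto the second factor has range `ran A` and is bounded below
  have hcl : IsClosed (A.graph : Set (H × H)) := hA.isClosed
  have : CompleteSpace A.graph := hcl.completeSpace_coe
  let π : A.graph →ₗ[𝕜] H := (LinearMap.snd 𝕜 H H).comp A.graph.subtype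
  have hπ : AntilipschitzWith (Real.toNNReal (max c⁻¹ 1)) π := by
    refine AddMonoidHomClass.antilipschitz_of_bound π fun p => ?_
    rw [Real.coe_toNNReal _ (by positivity)]
    obtain ⟨u, hu1, hu2⟩ := (LinearPMap.mem_graph_iff A).1 p.2
    have hb := LinearPMap.coercive_bound hc u
    rw [hu1, hu2] at hb
    change max ‖(p : H × H).1‖ ‖(p : H × H).2‖ ≤ _ * ‖(p : H × H).2‖
    refine max_le ?_ ?_
    · calc ‖(p : H × H).1‖ = c⁻¹ * (c * ‖(p : H × H).1‖) := by field_simp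
        _ ≤ c⁻¹ * ‖(p : H × H).2‖ := by gcongr
        _ ≤ _ := by gcongr; exact le_max_left _ _
    · exact le_mul_of_one_le_left (norm_nonneg _) (le_max_right _ _)
  have hcont : UniformContinuous π := uniformContinuous_snd.comp uniformContinuous_subtype_val
  have hrange : IsClosed (π.range : Set H) := hπ.isClosed_range hcont
  have hperp : π.rangeᗮ = ⊥ := by
    rw [Submodule.eq_bot_iff]
    intro x hx
    have hx' : ∀ u : A.domain, ⟪(0 : H), (u : H)⟫_𝕜 = ⟪x, A u⟫_𝕜 := fun u => by
      rw [inner_zero_left, eq_comm]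
      exact (Submodule.mem_orthogonal' _ _).1 hx _ ⟨⟨(u, A u), A.mem_graph u⟩, rfl⟩
    obtain ⟨hmem, hz'⟩ := hA.exists_apply_eq_of_inner_eq hx'
    have hb := LinearPMap.coercive_bound hc ⟨x, hmem⟩
    rw [hz', norm_zero] at hb
    exact norm_le_zero_iff.1 (by nlinarith [norm_nonneg x])
  have htop : π.range = ⊤ := by
    have : CompleteSpace π.range := hrange.completeSpace_coe
    exact Submodule.orthogonal_eq_bot_iff.1 hperp
  obtain ⟨p, hp⟩ : f ∈ π.range := htop ▸ Submodule.mem_top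
  obtain ⟨u, -, hu2⟩ := (LinearPMap.mem_graph_iff A).1 p.2
  exact ⟨u, hu2.trans hp⟩

/-- The inverse of a coercive self-adjoint operator with compact resolvent is a compact symmetric
operator. Compactness follows from the resolvent identity `A⁻¹ = (z - A)⁻¹ (z A⁻¹ - 1)`. -/
theorem IsSelfAdjoint.exists_compact_inverse [CompleteSpace H] {A : H →ₗ.[𝕜] H}
    (hA : IsSelfAdjoint A) (hco : IsCoerciveOperator A) (hcpt : HasCompactResolvent A) :
    ∃ T : H →L[𝕜] H, IsCompactOperator T ∧ (T : H →ₗ[𝕜] H).IsSymmetric ∧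
      ∀ f : H, ∃ h : T f ∈ A.domain, A ⟨T f, h⟩ = f := by
  obtain ⟨c, hc0, hc⟩ := hco
  have hb := LinearPMap.coercive_bound hc
  have hinj : ∀ u v : A.domain, A u = A v → u = v := fun u v h => by
    have := hb (u - v)
    rw [A.map_sub, h, sub_self, norm_zero] at this
    have h0 : ‖((u - v : A.domain) : H)‖ = 0 :=
      le_antisymm (by nlinarith [norm_nonneg ((u - v : A.domain) : H)]) (norm_nonneg _)
    exact sub_eq_zero.1 (Subtype.ext (norm_eq_zero.1 h0))
  choose g hg using fun f => hA.surjective_of_coercive hc0 hc f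
  let T₀ : H →ₗ[𝕜] H :=
    { toFun := fun f => g f
      map_add' := fun f f' => by
        rw [hinj (g (f + f')) (g f + g f') (by rw [A.map_add, hg, hg, hg])]; rfl
      map_smul' := fun k f => by
        rw [hinj (g (k • f)) (k • g f) (by rw [A.map_smul, hg, hg])]; rfl }
  let T : H →L[𝕜] H := T₀.mkContinuous c⁻¹ fun f => by
    have := hb (g f)
    rw [hg] at this
    calc ‖T₀ f‖ = c⁻¹ * (c * ‖(g f : H)‖) := by
          change ‖(g f : H)‖ = _
          field_simp
      _ ≤ c⁻¹ * ‖f‖ := by gcongr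
  refine ⟨T, ?_, fun x y => ?_, fun f => ⟨(g f).2, hg f⟩⟩
  · obtain ⟨z, R, hR, -, hR2⟩ := hcpt
    have : (T : H → H) = R ∘ (z • T - ContinuousLinearMap.id 𝕜 H : H →L[𝕜] H) := by
      funext f
      have h := hR2 (g f)
      rw [hg] at h
      exact h.symm
    rw [this]
    exact hR.comp_clm _
  · have := hA.inner_apply_left (g x) (g y)
    rw [hg, hg] at this
    exact this.symm

/-- A coercive self-adjoint operator with compact resolvent and simple spectrum has a Hilbert basis
of eigenvectors; the spectral theorem is applied to the compact inverse. -/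
theorem exists_hilbertBasis_isEigenpair [CompleteSpace H] {A : H →ₗ.[𝕜] H}
    (hA : IsSelfAdjoint A) (hco : IsCoerciveOperator A) (hcpt : HasCompactResolvent A)
    (hs : HasSimpleSpectrum A) :
    ∃ (ι : Type) (b : HilbertBasis ι 𝕜 H) (l : ι → ℝ) (c : ℝ), 0 < c ∧ (∀ i, c ≤ l i) ∧
      ∀ i, IsEigenpair A (l i) (b i) := by
  obtain ⟨T, hTc, hTs, hT⟩ := hA.exists_compact_inverse hco hcpt
  obtain ⟨c, hc0, hc⟩ := hco
  -- simplicity of the spectrum allows one unit eigenvector per eigenvalue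
  let ι := {l : ℝ // ∃ e : H, IsEigenpair A l e ∧ ‖e‖ = 1}
  choose e he he1 using fun i : ι => i.2
  have hsymm : ∀ i j : ι,
      ((i : ℝ) : 𝕜) * ⟪e i, e j⟫_𝕜 = ((j : ℝ) : 𝕜) * ⟪e i, e j⟫_𝕜 := fun i j => by
    obtain ⟨hi, hi'⟩ := he i
    obtain ⟨hj, hj'⟩ := he j
    have := hA.inner_apply_left ⟨e i, hi⟩ ⟨e j, hj⟩
    rw [hi', hj'] at this
    simpa [inner_smul_left, inner_smul_right] using this
  have hon : Orthonormal 𝕜 e := by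
    refine ⟨he1, fun i j hij => ?_⟩
    by_contra h
    exact hij (Subtype.ext (RCLike.ofReal_injective (mul_right_cancel₀ h (hsymm i j))))
  have hsp : (Submodule.span 𝕜 (Set.range e))ᗮ = ⊥ := by
    rw [Submodule.eq_bot_iff]
    intro x hx
    -- an eigenvector of `T` for `μ` is one of `A` for `μ⁻¹`, so a multiple of the chosen one
    have key : (⨆ μ, Module.End.eigenspace (T : H →ₗ[𝕜] H) μ)
        ≤ Submodule.span 𝕜 (Set.range e) := by
      refine iSup_le fun μ y hy => ?_
      rcases eq_or_ne y 0 with rfl | hy0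
      · exact Submodule.zero_mem _
      have hTy : T y = μ • y := Module.End.mem_eigenspace_iff.1 hy
      obtain ⟨hmem, hAT⟩ := hT y
      have hμ0 : μ ≠ 0 := by
        rintro rfl
        have h0 : (⟨T y, hmem⟩ : A.domain) = 0 := Subtype.ext (by simp [hTy])
        rw [h0, A.map_zero] at hAT
        exact hy0 hAT.symm
      have hμr : (starRingEnd 𝕜) μ = μ := hTs.conj_eigenvalue_eq_self
        (Module.End.hasEigenvalue_of_hasEigenvector ⟨hy, hy0⟩)
      have hymem : y ∈ A.domain := by
        have := A.domain.smul_mem μ⁻¹ hmem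
        rwa [hTy, inv_smul_smul₀ hμ0] at this
      have hAy : μ • A ⟨y, hymem⟩ = y := by
        rw [← A.map_smul]
        refine Eq.trans ?_ hAT
        congr 1
        exact Subtype.ext hTy.symm
      have hpair : IsEigenpair A (RCLike.re μ)⁻¹ y := by
        refine ⟨hymem, ?_⟩
        rw [RCLike.ofReal_inv, RCLike.conj_eq_iff_re.1 hμr]
        conv_rhs => rw [← hAy, inv_smul_smul₀ hμ0]
      have hny : ‖y‖ ≠ 0 := norm_ne_zero_iff.2 hy0
      have hpair' : IsEigenpair A (RCLike.re μ)⁻¹ (((‖y‖⁻¹ : ℝ) : 𝕜) • y) := by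
        obtain ⟨h1, h2⟩ := hpair
        refine ⟨A.domain.smul_mem _ h1, ?_⟩
        have := A.map_smul ((‖y‖⁻¹ : ℝ) : 𝕜) ⟨y, h1⟩
        rw [h2, smul_comm] at this
        exact this
      let i : ι := ⟨(RCLike.re μ)⁻¹, _, hpair', by
        rw [norm_smul, RCLike.norm_ofReal, abs_of_nonneg (by positivity), inv_mul_cancel₀ hny]⟩
      obtain ⟨k, hk⟩ := hs _ (e i) y (he i) hpair (by
        rw [← norm_ne_zero_iff, he1]; exact one_ne_zero)
      rw [hk]
      exact Submodule.smul_mem _ _ (Submodule.subset_span ⟨i, rfl⟩)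
    have hx' := Submodule.orthogonal_le key hx
    rw [ContinuousLinearMap.orthogonalComplement_iSup_eigenspaces_eq_bot hTc hTs] at hx'
    exact (Submodule.mem_bot 𝕜).1 hx'
  refine ⟨ι, HilbertBasis.mkOfOrthogonalEqBot hon hsp, fun i => i, c, hc0, fun i => ?_, fun i => ?_⟩
  · obtain ⟨h1, h2⟩ := he i
    have := hc ⟨e i, h1⟩
    rw [h2] at this
    simpa [inner_smul_left, he1 i, inner_self_eq_norm_sq_to_K] using this
  · rw [HilbertBasis.coe_mkOfOrthogonalEqBot]
    exact he i

variable {ι : Type*} (b : HilbertBasis ι 𝕜 H)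

theorem HilbertBasis.ext_inner {x y : H} (h : ∀ i, ⟪b i, x⟫_𝕜 = ⟪b i, y⟫_𝕜) : x = y := by
  refine b.repr.injective (lp.ext (funext fun i => ?_))
  rw [b.repr_apply_apply, b.repr_apply_apply, h]

theorem HilbertBasis.exists_inner_eq {f : ι → 𝕜} (hf : Memℓp f 2) :
    ∃ x : H, ∀ i, ⟪b i, x⟫_𝕜 = f i :=
  ⟨b.repr.symm ⟨f, hf⟩, fun i => by rw [← b.repr_apply_apply, LinearIsometryEquiv.apply_symm_apply]⟩

theorem HilbertBasis.hasSum_norm_inner_sq (x : H) :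
    HasSum (fun i => ‖⟪b i, x⟫_𝕜‖ ^ 2) (‖x‖ ^ 2) := by
  have h := lp.hasSum_norm (p := 2) (by norm_num) (b.repr x)
  simpa [b.repr_apply_apply] using h

variable {b} {l : ι → ℝ} {A : H →ₗ.[𝕜] H}

theorem IsSelfAdjoint.inner_eigenvector_apply [CompleteSpace H] (hA : IsSelfAdjoint A) {l : ℝ}
    {e : H} (he : IsEigenpair A l e) (u : A.domain) : ⟪e, A u⟫_𝕜 = (l : 𝕜) * ⟪e, (u : H)⟫_𝕜 := by
  obtain ⟨h1, h2⟩ := he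
  have := hA.inner_apply_left ⟨e, h1⟩ u
  rw [h2, inner_smul_left, RCLike.conj_ofReal] at this
  exact this.symm

/-- A self-adjoint operator is the multiplication by its eigenvalues, with maximal domain. -/
theorem IsSelfAdjoint.exists_apply_eq_iff [CompleteSpace H] (hA : IsSelfAdjoint A)
    (hb : ∀ i, IsEigenpair A (l i) (b i)) (u w : H) :
    (∃ h : u ∈ A.domain, A ⟨u, h⟩ = w) ↔ ∀ i, ⟪b i, w⟫_𝕜 = (l i : 𝕜) * ⟪b i, u⟫_𝕜 := by
  constructor
  · rintro ⟨h, rfl⟩ i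
    exact hA.inner_eigenvector_apply (hb i) ⟨u, h⟩
  · intro h
    have hx : ∀ v : A.domain, ⟪w, (v : H)⟫_𝕜 = ⟪u, A v⟫_𝕜 := fun v => by
      rw [← b.tsum_inner_mul_inner, ← b.tsum_inner_mul_inner u]
      refine tsum_congr fun i => ?_
      rw [hA.inner_eigenvector_apply (hb i), ← inner_conj_symm, h i, map_mul, RCLike.conj_ofReal,
        inner_conj_symm]
      ring
    exact hA.exists_apply_eq_of_inner_eq hx

/-- Membership in the graph of `A ^ s` can be tested on a Hilbert basis of eigenvectors. -/
theorem mem_fracPowGraph_iff [CompleteSpace H] (hA : IsSelfAdjoint A)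
    (hb : ∀ i, IsEigenpair A (l i) (b i)) (s : ℝ) (u w : H) :
    (u, w) ∈ fracPowGraph A s ↔ ∀ i, ⟪b i, w⟫_𝕜 = ((l i ^ s : ℝ) : 𝕜) * ⟪b i, u⟫_𝕜 := by
  constructor
  · exact fun h i => h _ _ (hb i)
  · intro h m e he
    change ⟪e, w⟫_𝕜 = ((m ^ s : ℝ) : 𝕜) * ⟪e, u⟫_𝕜
    rw [← b.tsum_inner_mul_inner, ← b.tsum_inner_mul_inner e u, ← tsum_mul_left]
    refine tsum_congr fun i => ?_
    rw [h i]
    -- eigenvectors for different eigenvalues are orthogonal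
    rcases eq_or_ne (l i) m with hl | hl
    · rw [hl]; ring
    · obtain ⟨h1, h2⟩ := hb i
      have := hA.inner_eigenvector_apply he ⟨b i, h1⟩
      rw [h2, inner_smul_right] at this
      have h0 : ⟪e, b i⟫_𝕜 = 0 := by
        by_contra h0
        exact hl (RCLike.ofReal_injective (mul_right_cancel₀ h0 this))
      rw [h0]; ring

/-- The graph of `fracPow A s` is `fracPowGraph A s`: the eigenvectors are complete, so the values
are unique and `Submodule.toLinearPMap` does not fall back on the zero map. -/
theorem exists_fracPow_apply_eq_iff [CompleteSpace H] (hA : IsSelfAdjoint A)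
    (hb : ∀ i, IsEigenpair A (l i) (b i)) (s : ℝ) (u w : H) :
    (∃ h : u ∈ (fracPow A s).domain, fracPow A s ⟨u, h⟩ = w) ↔
      ∀ i, ⟪b i, w⟫_𝕜 = ((l i ^ s : ℝ) : 𝕜) * ⟪b i, u⟫_𝕜 := by
  rw [← mem_fracPowGraph_iff hA hb, ← Submodule.toLinearPMap_graph_eq (fracPowGraph A s),
    LinearPMap.mem_graph_iff]
  · constructor
    · rintro ⟨h, h'⟩
      exact ⟨⟨u, h⟩, rfl, h'⟩
    · rintro ⟨⟨y, hy⟩, h1, h2⟩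
      dsimp at h1
      subst h1
      exact ⟨hy, h2⟩
  · rintro ⟨x, y⟩ hx h0
    refine b.ext_inner fun i => ?_
    have := (mem_fracPowGraph_iff hA hb s x y).1 hx i
    dsimp at h0 ⊢
    rw [this, h0]; simp

end Spectral

/-! ### Block diagonal semigroups on `ℓ²` -/

section DiagonalSemigroup

variable {𝕜 E ι : Type*} [RCLike 𝕜] [NormedAddCommGroup E] [InnerProductSpace 𝕜 E]

theorem hasDerivAt_exp_smul_apply [CompleteSpace E] [NormedSpace ℝ E] [IsScalarTower ℝ 𝕜 E]
    (M : E →L[𝕜] E) (x : E) (t : ℝ) : HasDerivAt (fun s : ℝ => NormedSpace.exp ((s : 𝕜) • M) x)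
      (M (NormedSpace.exp ((t : 𝕜) • M) x)) t := by
  have h1 := (hasDerivAt_exp_smul_const' (𝕂 := 𝕜) M (t : 𝕜)).clm_apply (hasDerivAt_const (t : 𝕜) x)
  have h2 : HasDerivAt (fun s : ℝ => (s : 𝕜)) 1 t := by
    simpa using (RCLike.ofRealCLM (K := 𝕜)).hasDerivAt (x := t)
  have h3 := HasDerivAt.scomp t h1 h2
  simpa [Function.comp_def] using h3

theorem norm_exp_smul_apply_le [CompleteSpace E] {M : E →L[𝕜] E}
    (hM : ∀ x, RCLike.re ⟪M x, x⟫_𝕜 ≤ 0) {t : ℝ} (ht : 0 ≤ t) (x : E) :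
    ‖NormedSpace.exp ((t : 𝕜) • M) x‖ ≤ ‖x‖ := by
  let _ : InnerProductSpace ℝ E := InnerProductSpace.rclikeToReal 𝕜 E
  have hd := hasDerivAt_exp_smul_apply M x
  have h2 := fun t => (hd t).norm_sq
  have hanti : Antitone fun s : ℝ => ‖NormedSpace.exp ((s : 𝕜) • M) x‖ ^ 2 := by
    refine antitone_of_hasDerivAt_nonpos h2 fun s => ?_
    have h3 := hM (NormedSpace.exp ((s : 𝕜) • M) x)
    rw [← inner_re_symm] at h3
    change 2 * RCLike.re
      ⟪NormedSpace.exp ((s : 𝕜) • M) x, M (NormedSpace.exp ((s : 𝕜) • M) x)⟫_𝕜 ≤ 0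
    linarith
  have h := hanti ht
  simp only [RCLike.ofReal_zero, zero_smul, NormedSpace.exp_zero, one_apply_eq_self] at h
  exact (sq_le_sq₀ (norm_nonneg _) (norm_nonneg _)).1 h

/-- The derivative of `exp (t M) x` is `exp (t M) (M x)`, of norm at most `‖M x‖`. This makes the
difference quotients of the semigroup dominated on the domain of its generator. -/
theorem norm_exp_smul_apply_sub_le [CompleteSpace E] {M : E →L[𝕜] E}
    (hM : ∀ x, RCLike.re ⟪M x, x⟫_𝕜 ≤ 0) {t : ℝ} (ht : 0 ≤ t) (x : E) :
    ‖NormedSpace.exp ((t : 𝕜) • M) x - x‖ ≤ t * ‖M x‖ := by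
  let _ : NormedSpace ℝ E := NormedSpace.restrictScalars ℝ 𝕜 E
  have h := norm_image_sub_le_of_norm_deriv_le_segment' (a := 0) (b := t) (C := ‖M x‖)
    (fun s _ => (hasDerivAt_exp_smul_apply M x s).hasDerivWithinAt) (fun s hs => by
      have hcomm : M * NormedSpace.exp ((s : 𝕜) • M) = NormedSpace.exp ((s : 𝕜) • M) * M :=
        ((Commute.refl M).smul_right (s : 𝕜)).exp_right
      have := congrArg (fun N : E →L[𝕜] E => N x) hcomm
      simp only [mul_apply_eq_comp] at this
      rw [this]
      exact norm_exp_smul_apply_le hM hs.1 (M x)) t ⟨ht, le_rfl⟩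
  simpa [mul_comm] using h

/-- Dominated convergence in `ℓ²`. -/
theorem lp.tendsto_two_of_dominated {α : Type*} {f : Filter α} {F : α → lp (fun _ : ι => E) 2}
    {g B : lp (fun _ : ι => E) 2} (hFg : ∀ i, Tendsto (fun a => F a i) f (𝓝 (g i)))
    (hB : ∀ᶠ a in f, ∀ i, ‖F a i‖ ≤ ‖B i‖) : Tendsto F f (𝓝 g) := by
  have hs : ∀ x : lp (fun _ : ι => E) 2, HasSum (fun i => ‖x i‖ ^ 2) (‖x‖ ^ 2) := fun x => by
    simpa using lp.hasSum_norm (p := 2) (by norm_num) x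
  have key : Tendsto (fun a => ∑' i, ‖(F a - g) i‖ ^ 2) f (𝓝 (∑' _ : ι, (0 : ℝ))) := by
    refine tendsto_tsum_of_dominated_convergence (bound := fun i => 2 * (‖B i‖ ^ 2 + ‖g i‖ ^ 2))
      (((hs B).add (hs g)).summable.mul_left 2) (fun i => ?_) ?_
    · have := ((hFg i).sub_const (g i)).norm.pow 2
      simpa using this
    · filter_upwards [hB] with a ha i
      rw [Real.norm_of_nonneg (by positivity)]
      have h1 : ‖(F a - g) i‖ ≤ ‖B i‖ + ‖g i‖ := by
        rw [lp.coeFn_sub, Pi.sub_apply]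
        exact (norm_sub_le _ _).trans (by gcongr; exact ha i)
      have := pow_le_pow_left₀ (norm_nonneg _) h1 2
      nlinarith [sq_nonneg (‖B i‖ - ‖g i‖)]
  rw [tsum_zero] at key
  rw [tendsto_iff_norm_sub_tendsto_zero]
  have := key.sqrt
  simp only [(hs _).tsum_eq, Real.sqrt_zero, Real.sqrt_sq (norm_nonneg _)] at this
  exact this

/-- The diagonal operator on `ℓ²` whose blocks are contractions. -/
noncomputable def lp.diagonal (N : ι → E →L[𝕜] E) (hN : ∀ i x, ‖N i x‖ ≤ ‖x‖) :
    lp (fun _ : ι => E) 2 →L[𝕜] lp (fun _ : ι => E) 2 :=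
  have hmem : ∀ x : lp (fun _ : ι => E) 2, Memℓp (fun i => N i (x i)) 2 := fun x =>
    memℓp_gen (((memℓp_gen_iff (by norm_num)).1 (lp.memℓp x)).of_nonneg_of_le
      (fun i => by positivity) fun i => by gcongr; exact hN i (x i))
  LinearMap.mkContinuous
    { toFun := fun x => ⟨fun i => N i (x i), hmem x⟩
      map_add' := fun x y => lp.ext (funext fun i => (N i).map_add _ _)
      map_smul' := fun k x => lp.ext (funext fun i => (N i).map_smul k _) } 1 fun x => by
    rw [one_mul]
    refine lp.norm_mono (by norm_num) fun i => hN i (x i)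

theorem lp.diagonal_apply (N : ι → E →L[𝕜] E) (hN : ∀ i x, ‖N i x‖ ≤ ‖x‖)
    (x : lp (fun _ : ι => E) 2) (i : ι) : lp.diagonal N hN x i = N i (x i) := rfl

theorem lp.norm_diagonal_apply_le (N : ι → E →L[𝕜] E) (hN : ∀ i x, ‖N i x‖ ≤ ‖x‖)
    (x : lp (fun _ : ι => E) 2) : ‖lp.diagonal N hN x‖ ≤ ‖x‖ :=
  lp.norm_mono (by norm_num) fun i => hN i (x i)

theorem NNReal.tendsto_coe_nhdsGT_zero :
    Tendsto (fun t : ℝ≥0 => (t : ℝ)) (𝓝[>] 0) (𝓝[≠] 0) := by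
  refine tendsto_nhdsWithin_iff.2 ⟨?_, ?_⟩
  · exact (NNReal.continuous_coe.tendsto' 0 0 rfl).mono_left nhdsWithin_le_nhds
  · filter_upwards [self_mem_nhdsWithin] with t ht
    exact (NNReal.coe_pos.2 ht).ne'

/-- Dissipative blocks `M i` define a contraction semigroup `exp (t M i)` on `ℓ²`, whose generator
is the block diagonal operator with maximal domain. -/
theorem exists_diagonal_semigroup [CompleteSpace E] (M : ι → E →L[𝕜] E)
    (hM : ∀ i x, RCLike.re ⟪M i x, x⟫_𝕜 ≤ 0) :
    ∃ S : ContractionC0Semigroup 𝕜 (lp (fun _ : ι => E) 2), ∀ x w : lp (fun _ : ι => E) 2,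
      (∀ i, w i = M i (x i)) ↔ Tendsto (fun t : ℝ≥0 => (((t : ℝ)⁻¹ : ℝ) : 𝕜) • (S.op t x - x))
        (𝓝[>] 0) (𝓝 w) := by
  let _ : NormedSpace ℝ E := NormedSpace.restrictScalars ℝ 𝕜 E
  have hN : ∀ (t : ℝ≥0) i x, ‖NormedSpace.exp (((t : ℝ) : 𝕜) • M i) x‖ ≤ ‖x‖ := fun t i x =>
    norm_exp_smul_apply_le (hM i) t.2 x
  let S : ContractionC0Semigroup 𝕜 (lp (fun _ : ι => E) 2) :=
    { op := fun t => lp.diagonal (fun i => NormedSpace.exp (((t : ℝ) : 𝕜) • M i)) (hN t)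
      op_zero := by
        ext x i
        simp [lp.diagonal_apply]
      op_add := fun s t => by
        ext x i
        have : NormedSpace.exp (((s + t : ℝ) : 𝕜) • M i)
            = NormedSpace.exp (((s : ℝ) : 𝕜) • M i) * NormedSpace.exp (((t : ℝ) : 𝕜) • M i) := by
          rw [RCLike.ofReal_add, add_smul]
          let _ : NormedAlgebra ℚ 𝕜 := NormedAlgebra.restrictScalars ℚ ℝ 𝕜
          let _ : NormedAlgebra ℚ (E →L[𝕜] E) := NormedAlgebra.restrictScalars ℚ 𝕜 _
          exact NormedSpace.exp_add_of_commute (((Commute.refl (M i)).smul_left _).smul_right _)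
        simp only [lp.diagonal_apply, ContinuousLinearMap.comp_apply, NNReal.coe_add, this,
          mul_apply_eq_comp]
      tendsto_zero := fun x => by
        refine lp.tendsto_two_of_dominated (B := x) (fun i => ?_)
          (Eventually.of_forall fun t i => hN t i (x i))
        have h := (hasDerivAt_exp_smul_apply (M i) (x i) 0).continuousAt.tendsto
        simp only [RCLike.ofReal_zero, zero_smul, NormedSpace.exp_zero,
          one_apply_eq_self] at h
        exact h.comp (NNReal.tendsto_coe_nhdsGT_zero.mono_right nhdsWithin_le_nhds)
      norm_op_le := fun t x => lp.norm_diagonal_apply_le _ _ x }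
  have hcoord : ∀ (x : lp (fun _ : ι => E) 2) i, Tendsto
      (fun t : ℝ≥0 => ((((t : ℝ)⁻¹ : ℝ) : 𝕜) • (S.op t x - x)) i) (𝓝[>] 0) (𝓝 (M i (x i))) := by
    intro x i
    have h := (hasDerivAt_exp_smul_apply (M i) (x i) 0).tendsto_slope
    simp only [RCLike.ofReal_zero, zero_smul, NormedSpace.exp_zero,
      one_apply_eq_self] at h
    refine (h.comp NNReal.tendsto_coe_nhdsGT_zero).congr fun t => ?_
    simp only [Function.comp, slope, RCLike.ofReal_zero, zero_smul, NormedSpace.exp_zero,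
      one_apply_eq_self, sub_zero, vsub_eq_sub]
    exact (RCLike.real_smul_eq_coe_smul (K := 𝕜) _ _)
  refine ⟨S, fun x w => ⟨fun h => ?_, fun h i => ?_⟩⟩
  · refine lp.tendsto_two_of_dominated (B := w) (fun i => h i ▸ hcoord x i) ?_
    filter_upwards [self_mem_nhdsWithin] with t ht i
    have ht' : 0 < (t : ℝ) := ht
    have h1 := norm_exp_smul_apply_sub_le (hM i) ht'.le (x i)
    rw [h i]
    change ‖(((t : ℝ)⁻¹ : ℝ) : 𝕜) • (NormedSpace.exp (((t : ℝ) : 𝕜) • M i) (x i) - x i)‖ ≤ _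
    rw [norm_smul, RCLike.norm_ofReal, abs_of_pos (by positivity), inv_mul_le_iff₀ ht']
    exact h1
  · have h2 : Tendsto (fun t : ℝ≥0 => ((((t : ℝ)⁻¹ : ℝ) : 𝕜) • (S.op t x - x)) i)
        (𝓝[>] 0) (𝓝 (w i)) :=
      ((lp.evalCLM 𝕜 (fun _ : ι => E) 2 i).continuous.tendsto w).comp h
    exact tendsto_nhds_unique h2 (hcoord x i)

end DiagonalSemigroup

/-! ### Semigroups and isometric isomorphisms -/

section Transport

variable {𝕜 X Y : Type*} [RCLike 𝕜] [SeminormedAddCommGroup X] [NormedSpace 𝕜 X]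
  [SeminormedAddCommGroup Y] [NormedSpace 𝕜 Y]

/-- The conjugate of a semigroup by an isometric isomorphism. -/
def ContractionC0Semigroup.conj (S : ContractionC0Semigroup 𝕜 Y) (J : X ≃ₗᵢ[𝕜] Y) :
    ContractionC0Semigroup 𝕜 X where
  op t := (J.symm.toContinuousLinearEquiv : Y →L[𝕜] X).comp
    ((S.op t).comp (J.toContinuousLinearEquiv : X →L[𝕜] Y))
  op_zero := by ext x; simp [S.op_zero]
  op_add s t := by ext x; simp [S.op_add]
  tendsto_zero x := by
    have := (J.symm.continuous.tendsto _).comp (S.tendsto_zero (J x))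
    rw [J.symm_apply_apply] at this
    exact this
  norm_op_le t x := by
    simpa using S.norm_op_le t (J x)

theorem ContractionC0Semigroup.tendsto_conj_iff (S : ContractionC0Semigroup 𝕜 Y) (J : X ≃ₗᵢ[𝕜] Y)
    (x w : X) :
    Tendsto (fun t : ℝ≥0 => (((t : ℝ)⁻¹ : ℝ) : 𝕜) • ((S.conj J).op t x - x)) (𝓝[>] 0) (𝓝 w) ↔
      Tendsto (fun t : ℝ≥0 => (((t : ℝ)⁻¹ : ℝ) : 𝕜) • (S.op t (J x) - J x)) (𝓝[>] 0)
        (𝓝 (J w)) := by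
  rw [J.isometry.isUniformInducing.isInducing.tendsto_nhds_iff]
  refine tendsto_congr fun t => ?_
  simp [ContractionC0Semigroup.conj]

end Transport

/-! ### The coupled operator in an eigenbasis -/

section Coordinates

variable {𝕜 H ι : Type*} [RCLike 𝕜] [NormedAddCommGroup H] [InnerProductSpace 𝕜 H]

theorem HilbertBasis.hasSum_norm_coord_sq {κ : Type*} [Fintype κ] (b : HilbertBasis ι 𝕜 H)
    (x : PiLp 2 fun _ : κ => H) :
    HasSum (fun i => ‖(WithLp.toLp 2 fun k => ⟪b i, x k⟫_𝕜 : EuclideanSpace 𝕜 κ)‖ ^ 2)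
      (‖x‖ ^ 2) := by
  simp only [EuclideanSpace.norm_sq_eq, PiLp.norm_sq_eq_of_L2]
  exact hasSum_sum fun k _ => b.hasSum_norm_inner_sq (x k)

/-- The coordinates of a tuple of vectors in a Hilbert basis, grouped by basis vector. -/
noncomputable def HilbertBasis.coord {κ : Type*} [Fintype κ] (b : HilbertBasis ι 𝕜 H) :
    (PiLp 2 fun _ : κ => H) →ₗ[𝕜] lp (fun _ : ι => EuclideanSpace 𝕜 κ) 2 where
  toFun x := ⟨fun i => WithLp.toLp 2 fun k => ⟪b i, x k⟫_𝕜,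
    memℓp_gen (by simpa using (b.hasSum_norm_coord_sq x).summable)⟩
  map_add' x y := by
    ext i k
    exact inner_add_right _ _ _
  map_smul' c x := by
    ext i k
    simp [inner_smul_right]

theorem HilbertBasis.norm_coord {κ : Type*} [Fintype κ] (b : HilbertBasis ι 𝕜 H)
    (x : PiLp 2 fun _ : κ => H) : ‖b.coord x‖ = ‖x‖ := by
  have h := lp.hasSum_norm (p := 2) (by norm_num) (b.coord x)
  simp only [ENNReal.toReal_ofNat, Real.rpow_ofNat] at h
  exact (sq_eq_sq₀ (norm_nonneg _) (norm_nonneg _)).1 (h.unique (b.hasSum_norm_coord_sq x))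

theorem HilbertBasis.coord_surjective {κ : Type*} [Fintype κ] (b : HilbertBasis ι 𝕜 H) :
    Function.Surjective (b.coord (κ := κ)) := by
  intro f
  have hf : ∀ k, Memℓp (fun i => f i k) 2 := fun k =>
    memℓp_gen (((memℓp_gen_iff (by norm_num)).1 (lp.memℓp f)).of_nonneg_of_le
      (fun i => by positivity) fun i => by gcongr; exact PiLp.norm_apply_le (f i) k)
  choose x hx using fun k => b.exists_inner_eq (hf k)
  refine ⟨WithLp.toLp 2 x, ?_⟩
  ext i k
  exact hx k i

variable [CompleteSpace H] {A : H →ₗ.[𝕜] H} {b : HilbertBasis ι 𝕜 H} {l : ι → ℝ}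

theorem inner_sqrtOp_apply (hA : IsSelfAdjoint A) (hb : ∀ i, IsEigenpair A (l i) (b i))
    (u : (sqrtOp A).domain) (i : ι) :
    ⟪b i, sqrtOp A u⟫_𝕜 = (√(l i) : 𝕜) * ⟪b i, (u : H)⟫_𝕜 := by
  rw [Real.sqrt_eq_rpow]
  exact (exists_fracPow_apply_eq_iff hA hb (1 / 2) u _).1 ⟨u.2, rfl⟩ i

theorem sqrtOp_surjective (hA : IsSelfAdjoint A) (hb : ∀ i, IsEigenpair A (l i) (b i)) {c : ℝ}
    (hc : 0 < c) (hl : ∀ i, c ≤ l i) (w : H) : ∃ u, sqrtOp A u = w := by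
  have hw : Memℓp (fun i => ⟪b i, w⟫_𝕜) 2 :=
    memℓp_gen (by simpa using (b.hasSum_norm_inner_sq w).summable)
  have hm : Memℓp (fun i => ((√(l i))⁻¹ : 𝕜) * ⟪b i, w⟫_𝕜) 2 := by
    refine memℓp_gen (Summable.of_nonneg_of_le (fun i => by positivity) (fun i => ?_)
      (((memℓp_gen_iff (by norm_num)).1 hw).mul_left (c⁻¹)))
    have hli : 0 < l i := hc.trans_le (hl i)
    simp only [ENNReal.toReal_ofNat, Real.rpow_ofNat, norm_mul, mul_pow, norm_inv,
      RCLike.norm_ofReal, abs_of_nonneg (Real.sqrt_nonneg _), inv_pow, Real.sq_sqrt hli.le]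
    gcongr
    exact hl i
  obtain ⟨u, hu⟩ := b.exists_inner_eq hm
  obtain ⟨h, h'⟩ := (exists_fracPow_apply_eq_iff hA hb (1 / 2) u w).2 fun i => by
    have hli : 0 < l i := hc.trans_le (hl i)
    have : (√(l i) : 𝕜) ≠ 0 := RCLike.ofReal_ne_zero.2 (Real.sqrt_ne_zero'.2 hli)
    rw [hu, ← Real.sqrt_eq_rpow, mul_inv_cancel_left₀ this]
  exact ⟨⟨u, h⟩, h'⟩

theorem sqrtOp_injective (hA : IsSelfAdjoint A) (hb : ∀ i, IsEigenpair A (l i) (b i))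
    (hl : ∀ i, 0 < l i) : Function.Injective (sqrtOp A) := by
  intro u v h
  refine Subtype.ext (b.ext_inner fun i => ?_)
  have h1 := congrArg (fun x => ⟪b i, x⟫_𝕜) h
  simp only [inner_sqrtOp_apply hA hb] at h1
  exact mul_left_cancel₀ (RCLike.ofReal_ne_zero.2 (Real.sqrt_ne_zero'.2 (hl i))) h1

theorem EnergySpace.toHilbertSum_bijective (hA : IsSelfAdjoint A)
    (hb : ∀ i, IsEigenpair A (l i) (b i)) {c : ℝ} (hc : 0 < c) (hl : ∀ i, c ≤ l i) :
    Function.Bijective (EnergySpace.toHilbertSum A) := by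
  have hinj := sqrtOp_injective hA hb fun i => hc.trans_le (hl i)
  constructor
  · intro U W h
    have h' := fun k => congrArg (fun x : PiLp 2 (fun _ : Fin 4 => H) => x k) h
    exact Prod.ext (hinj (h' 0)) (Prod.ext (h' 1) (Prod.ext (hinj (h' 2)) (h' 3)))
  · intro w
    obtain ⟨u, hu⟩ := sqrtOp_surjective hA hb hc hl (w 0)
    obtain ⟨y, hy⟩ := sqrtOp_surjective hA hb hc hl (w 2)
    refine ⟨EnergySpace.mk u (w 1) y (w 3), ?_⟩
    ext k
    fin_cases k
    · exact hu
    · rfl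
    · exact hy
    · rfl

/-- The energy space as an `ℓ²` sum, over an eigenbasis of `A`, of four-dimensional spaces. -/
noncomputable def EnergySpace.coord (hA : IsSelfAdjoint A)
    (hb : ∀ i, IsEigenpair A (l i) (b i)) {c : ℝ} (hc : 0 < c) (hl : ∀ i, c ≤ l i) :
    EnergySpace A ≃ₗᵢ[𝕜] lp (fun _ : ι => EuclideanSpace 𝕜 (Fin 4)) 2 where
  toLinearEquiv := LinearEquiv.ofBijective (b.coord.comp (EnergySpace.toHilbertSum A)) <| by
    have h : Function.Injective (b.coord (κ := Fin 4)) := by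
      refine (injective_iff_map_eq_zero _).2 fun x hx => ?_
      rw [← norm_eq_zero, ← b.norm_coord, hx, norm_zero]
    have h2 := EnergySpace.toHilbertSum_bijective hA hb hc hl
    exact ⟨h.comp h2.1, b.coord_surjective.comp h2.2⟩
  norm_map' U := b.norm_coord _

theorem EnergySpace.coord_apply (hA : IsSelfAdjoint A)
    (hb : ∀ i, IsEigenpair A (l i) (b i)) {c : ℝ} (hc : 0 < c) (hl : ∀ i, c ≤ l i)
    (U : EnergySpace A) (i : ι) : EnergySpace.coord hA hb hc hl U i =
      !₂[(√(l i) : 𝕜) * ⟪b i, (U.u : H)⟫_𝕜, ⟪b i, U.v⟫_𝕜,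
        (√(l i) : 𝕜) * ⟪b i, (U.y : H)⟫_𝕜, ⟪b i, U.z⟫_𝕜] := by
  rw [← inner_sqrtOp_apply hA hb, ← inner_sqrtOp_apply hA hb]
  ext k
  fin_cases k <;> rfl

/-- The block of the coupled system on the mode of frequency `ω`, in the coordinates
`(ω u, v, ω y, z)`. -/
noncomputable def modeBlock (𝕜 : Type*) [RCLike 𝕜] (ω α : ℝ) :
    EuclideanSpace 𝕜 (Fin 4) →L[𝕜] EuclideanSpace 𝕜 (Fin 4) :=
  LinearMap.toContinuousLinearMap
    { toFun := fun p => !₂[(ω : 𝕜) * p 1, -((ω : 𝕜) * p 0) - p 1 - (α : 𝕜) * p 3,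
        (ω : 𝕜) * p 3, -((ω : 𝕜) * p 2) + (α : 𝕜) * p 1]
      map_add' := fun p q => by
        ext k
        fin_cases k <;> simp <;> ring
      map_smul' := fun c p => by
        ext k
        fin_cases k <;> simp <;> ring }

theorem modeBlock_apply (ω α : ℝ) (p : EuclideanSpace 𝕜 (Fin 4)) :
    modeBlock 𝕜 ω α p = !₂[(ω : 𝕜) * p 1, -((ω : 𝕜) * p 0) - p 1 - (α : 𝕜) * p 3,
        (ω : 𝕜) * p 3, -((ω : 𝕜) * p 2) + (α : 𝕜) * p 1] := rfl

theorem re_inner_modeBlock_nonpos (ω α : ℝ) (p : EuclideanSpace 𝕜 (Fin 4)) :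
    RCLike.re ⟪modeBlock 𝕜 ω α p, p⟫_𝕜 ≤ 0 := by
  have : RCLike.re ⟪modeBlock 𝕜 ω α p, p⟫_𝕜 = -(RCLike.re (p 1) ^ 2 + RCLike.im (p 1) ^ 2) := by
    simp [PiLp.inner_apply, modeBlock_apply, Fin.sum_univ_four]
    ring
  rw [this]
  nlinarith [sq_nonneg (RCLike.re (p 1)), sq_nonneg (RCLike.im (p 1))]

/-- In the coordinates of an eigenbasis of `A` the coupled operator is block diagonal, with maximal
domain. -/
theorem exists_coupledOperator_apply_eq_iff (hA : IsSelfAdjoint A)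
    (hb : ∀ i, IsEigenpair A (l i) (b i)) {c : ℝ} (hc : 0 < c) (hl : ∀ i, c ≤ l i) (α : ℝ)
    (U W : EnergySpace A) :
    (∃ hU : U ∈ (coupledOperator A α).domain, coupledOperator A α ⟨U, hU⟩ = W) ↔
      ∀ i, EnergySpace.coord hA hb hc hl W i
        = modeBlock 𝕜 (√(l i)) α (EnergySpace.coord hA hb hc hl U i) := by
  have hsq : ∀ i, (√(l i) : 𝕜) * (√(l i) : 𝕜) = (l i : 𝕜) := fun i => by
    rw [← RCLike.ofReal_mul, Real.mul_self_sqrt (hc.le.trans (hl i))]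
  have hne : ∀ i, (√(l i) : 𝕜) ≠ 0 := fun i =>
    RCLike.ofReal_ne_zero.2 (Real.sqrt_ne_zero'.2 (hc.trans_le (hl i)))
  have forward : ∀ hU : U ∈ (coupledOperator A α).domain, ∀ i,
      EnergySpace.coord hA hb hc hl (coupledOperator A α ⟨U, hU⟩) i
        = modeBlock 𝕜 (√(l i)) α (EnergySpace.coord hA hb hc hl U i) := by
    intro hU i
    rw [modeBlock_apply, EnergySpace.coord_apply, EnergySpace.coord_apply]
    ext k
    fin_cases k
    · rfl
    · change ⟪b i, -A ⟨(U.u : H), hU.1⟩ - U.v - (α : 𝕜) • U.z⟫_𝕜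
        = -((√(l i) : 𝕜) * ((√(l i) : 𝕜) * ⟪b i, (U.u : H)⟫_𝕜)) - ⟪b i, U.v⟫_𝕜
          - (α : 𝕜) * ⟪b i, U.z⟫_𝕜
      rw [inner_sub_right, inner_sub_right, inner_neg_right, inner_smul_right,
        hA.inner_eigenvector_apply (hb i), ← mul_assoc, hsq]
    · rfl
    · change ⟪b i, -A ⟨(U.y : H), hU.2.2.1⟩ + (α : 𝕜) • U.v⟫_𝕜
        = -((√(l i) : 𝕜) * ((√(l i) : 𝕜) * ⟪b i, (U.y : H)⟫_𝕜)) + (α : 𝕜) * ⟪b i, U.v⟫_𝕜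
      rw [inner_add_right, inner_neg_right, inner_smul_right,
        hA.inner_eigenvector_apply (hb i), ← mul_assoc, hsq]
  constructor
  · rintro ⟨hU, rfl⟩
    exact forward hU
  · intro h
    have h' := fun i k => congrArg (fun p : EuclideanSpace 𝕜 (Fin 4) => p k) (h i)
    simp only [modeBlock_apply, EnergySpace.coord_apply] at h'
    have h0 : (W.u : H) = U.v := b.ext_inner fun i => mul_left_cancel₀ (hne i) (h' i 0)
    have h2 : (W.y : H) = U.z := b.ext_inner fun i => mul_left_cancel₀ (hne i) (h' i 2)
    have h1 : ∀ i, ⟪b i, W.v⟫_𝕜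
        = -((√(l i) : 𝕜) * ((√(l i) : 𝕜) * ⟪b i, (U.u : H)⟫_𝕜)) - ⟪b i, U.v⟫_𝕜
          - (α : 𝕜) * ⟪b i, U.z⟫_𝕜 := fun i => h' i 1
    have h3 : ∀ i, ⟪b i, W.z⟫_𝕜
        = -((√(l i) : 𝕜) * ((√(l i) : 𝕜) * ⟪b i, (U.y : H)⟫_𝕜)) + (α : 𝕜) * ⟪b i, U.v⟫_𝕜 :=
      fun i => h' i 3
    obtain ⟨hu, -⟩ := (hA.exists_apply_eq_iff hb (U.u : H) (-(W.v + U.v + (α : 𝕜) • U.z))).2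
      fun i => by
        rw [inner_neg_right, inner_add_right, inner_add_right, inner_smul_right, h1, ← hsq]
        ring
    obtain ⟨hy, -⟩ := (hA.exists_apply_eq_iff hb (U.y : H) ((α : 𝕜) • U.v - W.z)).2
      fun i => by
        rw [inner_sub_right, inner_smul_right, h3, ← hsq]
        ring
    have hU : U ∈ (coupledOperator A α).domain := ⟨hu, h0 ▸ W.u.2, hy, h2 ▸ W.y.2⟩
    exact ⟨hU, (EnergySpace.coord hA hb hc hl).injective
      (lp.ext (funext fun i => (forward hU i).trans (h i).symm))⟩

/-- The domain contains all vectors supported on finitely many modes. -/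
theorem coupledOperator_dense_domain (hA : IsSelfAdjoint A)
    (hb : ∀ i, IsEigenpair A (l i) (b i)) {c : ℝ} (hc : 0 < c) (hl : ∀ i, c ≤ l i) (α : ℝ) :
    Dense ((coupledOperator A α).domain : Set (EnergySpace A)) := by
  classical
  intro U
  set J := EnergySpace.coord hA hb hc hl
  have hsingle : ∀ i a, J.symm (lp.single 2 i a) ∈ (coupledOperator A α).domain := fun i a => by
    refine ((exists_coupledOperator_apply_eq_iff hA hb hc hl α _
      (J.symm (lp.single 2 i (modeBlock 𝕜 (√(l i)) α a)))).2 fun j => ?_).1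
    change J (J.symm _) j = modeBlock 𝕜 _ α (J (J.symm _) j)
    rw [J.apply_symm_apply, J.apply_symm_apply]
    rcases eq_or_ne j i with rfl | hj
    · rw [lp.single_apply_self, lp.single_apply_self]
    · rw [lp.single_apply_ne _ _ _ hj, lp.single_apply_ne _ _ _ hj, map_zero]
  have hsum := (lp.hasSum_single (p := 2) (by norm_num) (J U)).map J.symm J.symm.continuous
  rw [J.symm_apply_apply] at hsum
  exact mem_closure_of_tendsto hsum (Eventually.of_forall fun s =>
    Submodule.sum_mem _ fun i _ => hsingle i _)

theorem exists_isGeneratedBy_coupledOperator (hA : IsSelfAdjoint A)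
    (hb : ∀ i, IsEigenpair A (l i) (b i)) {c : ℝ} (hc : 0 < c) (hl : ∀ i, c ≤ l i) (α : ℝ) :
    ∃ S : ContractionC0Semigroup 𝕜 (EnergySpace A), S.IsGeneratedBy (coupledOperator A α) := by
  obtain ⟨S, hS⟩ := exists_diagonal_semigroup (fun i => modeBlock 𝕜 (√(l i)) α)
    fun i => re_inner_modeBlock_nonpos _ _
  refine ⟨S.conj (EnergySpace.coord hA hb hc hl), fun U W => ?_⟩
  rw [S.tendsto_conj_iff, ← hS]
  exact exists_coupledOperator_apply_eq_iff hA hb hc hl α U W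

end Coordinates

/-! ### A Lyapunov function for the coupled system -/

section Lyapunov

/-- Small weights `d` and `e` for the two correction terms of the Lyapunov function: the first
inequality makes the function comparable to the energy, the second one makes it decay. -/
theorem exists_lyapunov_weights {a k : ℝ} (ha : 0 < a) (hk : 0 < k) :
    ∃ d e m : ℝ, 0 < d ∧ 0 < e ∧ 0 < m ∧ ∀ P Q R T : ℝ,
      d * (Q * T + P * R) + e * (k * (P * Q) + k * (R * T))
          ≤ (P ^ 2 + Q ^ 2 + R ^ 2 + T ^ 2) / 4 ∧
      -Q ^ 2 + d * (Q * T - a * T ^ 2 + a * Q ^ 2)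
          + e * (Q ^ 2 - P ^ 2 + k * (P * Q) + a * k * (P * T) + T ^ 2 - R ^ 2 + a * k * (R * Q))
        ≤ -m * (P ^ 2 + Q ^ 2 + R ^ 2 + T ^ 2) := by
  -- `h` is the ratio of the two weights: the second correction then costs only a third of the
  -- damping `3 a / 4` of `z` that the first one provides
  set h : ℝ := a / (4 * (1 + a ^ 2 * k ^ 2)) with hh
  have hh0 : 0 < h := by positivity
  have hh1 : h * (1 + a ^ 2 * k ^ 2) = a / 4 := by rw [hh]; field_simp
  -- `1 + h * k` bounds the size of the corrections, the rest of `K` their terms in `v`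
  set K : ℝ := a⁻¹ + a + h * (1 + k ^ 2 + a ^ 2 * k ^ 2) + (1 + h * k) with hK
  have hK0 : 0 < K := by positivity
  set d : ℝ := 1 / (2 * K) with hd
  have hd0 : 0 < d := by positivity
  have hdK : d * K = 1 / 2 := by rw [hd]; field_simp
  have hd1 : d * (1 + h * k) ≤ 1 / 2 := by
    rw [← hdK]
    gcongr
    have : 0 ≤ a⁻¹ + a + h * (1 + k ^ 2 + a ^ 2 * k ^ 2) := by positivity
    linarith
  have hd2 : d * (a⁻¹ + a + h * (1 + k ^ 2 + a ^ 2 * k ^ 2)) ≤ 1 / 2 := by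
    rw [← hdK]
    gcongr
    have : 0 ≤ 1 + h * k := by positivity
    linarith
  refine ⟨d, d * h, min (1 / 2) (min (d * a / 2) (d * h / 2)), hd0, by positivity, by positivity,
    fun P Q R T => ⟨?_, ?_⟩⟩
  · have h1 : Q * T + P * R ≤ (P ^ 2 + Q ^ 2 + R ^ 2 + T ^ 2) / 2 := by
      nlinarith [sq_nonneg (Q - T), sq_nonneg (P - R)]
    have h2 : P * Q + R * T ≤ (P ^ 2 + Q ^ 2 + R ^ 2 + T ^ 2) / 2 := by
      nlinarith [sq_nonneg (P - Q), sq_nonneg (R - T)]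
    calc d * (Q * T + P * R) + d * h * (k * (P * Q) + k * (R * T))
        = d * (Q * T + P * R) + d * h * k * (P * Q + R * T) := by ring
      _ ≤ d * ((P ^ 2 + Q ^ 2 + R ^ 2 + T ^ 2) / 2)
          + d * h * k * ((P ^ 2 + Q ^ 2 + R ^ 2 + T ^ 2) / 2) := by gcongr
      _ = d * (1 + h * k) * ((P ^ 2 + Q ^ 2 + R ^ 2 + T ^ 2) / 2) := by ring
      _ ≤ 1 / 2 * ((P ^ 2 + Q ^ 2 + R ^ 2 + T ^ 2) / 2) := by gcongr
      _ = _ := by ring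
  · -- Young's inequality for each mixed term
    have y1 : Q * T ≤ a / 4 * T ^ 2 + a⁻¹ * Q ^ 2 := by
      have : a / 4 * T ^ 2 + a⁻¹ * Q ^ 2 - Q * T = a⁻¹ * (a / 2 * T - Q) ^ 2 := by
        field_simp; ring
      have : 0 ≤ a⁻¹ * (a / 2 * T - Q) ^ 2 := by positivity
      linarith
    have y2 : k * (P * Q) ≤ P ^ 2 / 4 + k ^ 2 * Q ^ 2 := by nlinarith [sq_nonneg (P / 2 - k * Q)]
    have y3 : a * k * (P * T) ≤ P ^ 2 / 4 + a ^ 2 * k ^ 2 * T ^ 2 := by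
      nlinarith [sq_nonneg (P / 2 - a * k * T)]
    have y4 : a * k * (R * Q) ≤ R ^ 2 / 2 + a ^ 2 * k ^ 2 * Q ^ 2 := by
      nlinarith [sq_nonneg (R / 2 - a * k * Q), sq_nonneg R]
    set m := min (1 / 2) (min (d * a / 2) (d * h / 2))
    have m1 : m ≤ 1 / 2 := min_le_left _ _
    have m2 : m ≤ d * a / 2 := (min_le_right _ _).trans (min_le_left _ _)
    have m3 : m ≤ d * h / 2 := (min_le_right _ _).trans (min_le_right _ _)
    calc -Q ^ 2 + d * (Q * T - a * T ^ 2 + a * Q ^ 2)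
          + d * h * (Q ^ 2 - P ^ 2 + k * (P * Q) + a * k * (P * T) + T ^ 2 - R ^ 2
            + a * k * (R * Q))
        ≤ -Q ^ 2 + d * (a / 4 * T ^ 2 + a⁻¹ * Q ^ 2 - a * T ^ 2 + a * Q ^ 2)
          + d * h * (Q ^ 2 - P ^ 2 + (P ^ 2 / 4 + k ^ 2 * Q ^ 2)
            + (P ^ 2 / 4 + a ^ 2 * k ^ 2 * T ^ 2) + T ^ 2 - R ^ 2
            + (R ^ 2 / 2 + a ^ 2 * k ^ 2 * Q ^ 2)) := by gcongr
      _ = -(1 - d * (a⁻¹ + a + h * (1 + k ^ 2 + a ^ 2 * k ^ 2))) * Q ^ 2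
          + d * (h * (1 + a ^ 2 * k ^ 2) - 3 * a / 4) * T ^ 2
          - d * h / 2 * P ^ 2 - d * h / 2 * R ^ 2 := by ring
      _ = -(1 - d * (a⁻¹ + a + h * (1 + k ^ 2 + a ^ 2 * k ^ 2))) * Q ^ 2
          - d * a / 2 * T ^ 2 - d * h / 2 * P ^ 2 - d * h / 2 * R ^ 2 := by rw [hh1]; ring
      _ ≤ -m * Q ^ 2 - m * T ^ 2 - m * P ^ 2 - m * R ^ 2 := by
          gcongr
          linarith
      _ = _ := by ring

variable {G : Type*} [NormedAddCommGroup G] [InnerProductSpace ℝ G]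

/-- The Lyapunov function: the energy of `(u, v, y, z)`, where `p` and `r` stand for `A ^ (1/2) u`
and `A ^ (1/2) y`, with two correction terms. -/
noncomputable def lyapunov (d e : ℝ) (u p v y r z : G) : ℝ :=
  (‖p‖ ^ 2 + ‖v‖ ^ 2 + ‖r‖ ^ 2 + ‖z‖ ^ 2) / 2 + d * (⟪v, z⟫_ℝ + ⟪p, r⟫_ℝ)
    + e * (⟪u, v⟫_ℝ + ⟪y, z⟫_ℝ)

theorem abs_lyapunov_sub_le {d e k : ℝ} (he : 0 ≤ e) {u p v y r z : G}
    (hu : ‖u‖ ≤ k * ‖p‖) (hy : ‖y‖ ≤ k * ‖r‖) :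
    |lyapunov d e u p v y r z - (‖p‖ ^ 2 + ‖v‖ ^ 2 + ‖r‖ ^ 2 + ‖z‖ ^ 2) / 2|
      ≤ |d| * (‖v‖ * ‖z‖ + ‖p‖ * ‖r‖) + e * (k * (‖p‖ * ‖v‖) + k * (‖r‖ * ‖z‖)) := by
  have h1 : |⟪v, z⟫_ℝ + ⟪p, r⟫_ℝ| ≤ ‖v‖ * ‖z‖ + ‖p‖ * ‖r‖ :=
    (abs_add_le _ _).trans (add_le_add (abs_real_inner_le_norm _ _) (abs_real_inner_le_norm _ _))
  have h2 : |⟪u, v⟫_ℝ + ⟪y, z⟫_ℝ| ≤ k * (‖p‖ * ‖v‖) + k * (‖r‖ * ‖z‖) := by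
    refine (abs_add_le _ _).trans (add_le_add ?_ ?_)
    · rw [← mul_assoc]
      exact (abs_real_inner_le_norm _ _).trans (by gcongr)
    · rw [← mul_assoc]
      exact (abs_real_inner_le_norm _ _).trans (by gcongr)
  calc _ = |d * (⟪v, z⟫_ℝ + ⟪p, r⟫_ℝ) + e * (⟪u, v⟫_ℝ + ⟪y, z⟫_ℝ)| := by
        rw [lyapunov]; congr 1; ring
    _ ≤ |d| * |⟪v, z⟫_ℝ + ⟪p, r⟫_ℝ| + e * |⟪u, v⟫_ℝ + ⟪y, z⟫_ℝ| := by
        refine (abs_add_le _ _).trans ?_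
        rw [abs_mul, abs_mul, abs_of_nonneg he]
    _ ≤ _ := by gcongr

/-- The derivative of the Lyapunov function along a solution of the coupled system, where `f`, `g`,
`p'`, `r'` stand for `A u`, `A y`, `A ^ (1/2) v`, `A ^ (1/2) z`. The mixed terms
`⟪f, z⟫ + ⟪g, v⟫`, which are not bounded by the energy, cancel. -/
theorem hasDerivWithinAt_lyapunov {u p v y r z : ℝ → G} {s : Set ℝ} {t α : ℝ} {f g p' r' : G}
    (d e : ℝ) (hu : HasDerivWithinAt u (v t) s t) (hp : HasDerivWithinAt p p' s t)
    (hv : HasDerivWithinAt v (-f - v t - α • z t) s t) (hy : HasDerivWithinAt y (z t) s t)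
    (hr : HasDerivWithinAt r r' s t) (hz : HasDerivWithinAt z (-g + α • v t) s t)
    (hfv : ⟪f, v t⟫_ℝ = ⟪p t, p'⟫_ℝ) (hfz : ⟪f, z t⟫_ℝ = ⟪p t, r'⟫_ℝ)
    (hgv : ⟪g, v t⟫_ℝ = ⟪r t, p'⟫_ℝ) (hgz : ⟪g, z t⟫_ℝ = ⟪r t, r'⟫_ℝ)
    (hfu : ⟪f, u t⟫_ℝ = ‖p t‖ ^ 2) (hgy : ⟪g, y t⟫_ℝ = ‖r t‖ ^ 2) :
    HasDerivWithinAt (fun x => lyapunov d e (u x) (p x) (v x) (y x) (r x) (z x))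
      (-‖v t‖ ^ 2 + d * (-⟪v t, z t⟫_ℝ - α * ‖z t‖ ^ 2 + α * ‖v t‖ ^ 2)
        + e * (‖v t‖ ^ 2 - ‖p t‖ ^ 2 - ⟪u t, v t⟫_ℝ - α * ⟪u t, z t⟫_ℝ
          + ‖z t‖ ^ 2 - ‖r t‖ ^ 2 + α * ⟪y t, v t⟫_ℝ)) s t := by
  have h := ((((hp.norm_sq.add hv.norm_sq).add hr.norm_sq).add hz.norm_sq).div_const 2).add
    (((hv.inner ℝ hz).add (hp.inner ℝ hr)).const_mul d) |>.add
    (((hu.inner ℝ hv).add (hy.inner ℝ hz)).const_mul e)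
  refine h.congr_deriv ?_
  simp only [inner_add_right, inner_sub_right, inner_neg_right, inner_smul_right,
    inner_sub_left, inner_neg_left, real_inner_smul_left, real_inner_self_eq_norm_sq]
  rw [real_inner_comm f (v t), real_inner_comm g (v t), real_inner_comm g (z t),
    real_inner_comm f (u t), real_inner_comm g (y t), real_inner_comm (r t) p',
    real_inner_comm (v t) (z t), hfv, hfz, hgv, hgz, hfu, hgy]
  ring

/-- Solutions of the coupled system decay exponentially, with a rate depending only on `α` and on
the constant `k` bounding `u` by `A ^ (1/2) u`. -/
theorem exists_energy_decay_rate {α k : ℝ} (hα : α ≠ 0) (hk : 0 < k) :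
    ∃ m : ℝ, 0 < m ∧ ∀ {G : Type*} [NormedAddCommGroup G] [InnerProductSpace ℝ G]
      {u p v y r z f g p' r' : ℝ → G},
      Continuous u → Continuous p → Continuous v → Continuous y → Continuous r → Continuous z →
      (∀ t, 0 ≤ t → HasDerivWithinAt u (v t) (Set.Ici t) t) →
      (∀ t, 0 ≤ t → HasDerivWithinAt p (p' t) (Set.Ici t) t) →
      (∀ t, 0 ≤ t → HasDerivWithinAt v (-f t - v t - α • z t) (Set.Ici t) t) →
      (∀ t, 0 ≤ t → HasDerivWithinAt y (z t) (Set.Ici t) t) →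
      (∀ t, 0 ≤ t → HasDerivWithinAt r (r' t) (Set.Ici t) t) →
      (∀ t, 0 ≤ t → HasDerivWithinAt z (-g t + α • v t) (Set.Ici t) t) →
      (∀ t, ⟪f t, v t⟫_ℝ = ⟪p t, p' t⟫_ℝ) → (∀ t, ⟪f t, z t⟫_ℝ = ⟪p t, r' t⟫_ℝ) →
      (∀ t, ⟪g t, v t⟫_ℝ = ⟪r t, p' t⟫_ℝ) → (∀ t, ⟪g t, z t⟫_ℝ = ⟪r t, r' t⟫_ℝ) →
      (∀ t, ⟪f t, u t⟫_ℝ = ‖p t‖ ^ 2) → (∀ t, ⟪g t, y t⟫_ℝ = ‖r t‖ ^ 2) →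
      (∀ t, ‖u t‖ ≤ k * ‖p t‖) → (∀ t, ‖y t‖ ≤ k * ‖r t‖) →
      ∀ t, 0 ≤ t → ‖p t‖ ^ 2 + ‖v t‖ ^ 2 + ‖r t‖ ^ 2 + ‖z t‖ ^ 2
        ≤ 4 * Real.exp (-m * t) * (‖p 0‖ ^ 2 + ‖v 0‖ ^ 2 + ‖r 0‖ ^ 2 + ‖z 0‖ ^ 2) := by
  have ha : 0 < |α| := abs_pos.2 hα
  obtain ⟨d, e, m, hd, he, hm, hw⟩ := exists_lyapunov_weights ha hk
  refine ⟨m, hm, ?_⟩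
  intro G _ _ u p v y r z f g p' r' cu cp cv cy cr cz hu hp hv hy hr hz hfv hfz hgv hgz hfu hgy
    hku hky
  -- the sign of the first weight makes its contribution to the derivative negative in `z`
  obtain ⟨σ, hσα, hσ1⟩ : ∃ σ : ℝ, σ * α = |α| ∧ |σ| = 1 := by
    rcases le_total 0 α with h | h
    · exact ⟨1, by rw [one_mul, abs_of_nonneg h], abs_one⟩
    · exact ⟨-1, by rw [neg_one_mul, abs_of_nonpos h], by norm_num⟩
  set V : ℝ → ℝ := fun t => lyapunov (d * σ) e (u t) (p t) (v t) (y t) (r t) (z t) with hV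
  set N : ℝ → ℝ := fun t => ‖p t‖ ^ 2 + ‖v t‖ ^ 2 + ‖r t‖ ^ 2 + ‖z t‖ ^ 2 with hN
  have hVN : ∀ t, |V t - N t / 2| ≤ N t / 4 := fun t => by
    refine (abs_lyapunov_sub_le he.le (hku t) (hky t)).trans ?_
    rw [abs_mul, hσ1, mul_one, abs_of_pos hd]
    exact (hw ‖p t‖ ‖v t‖ ‖r t‖ ‖z t‖).1
  have hVc : Continuous V := by
    simp only [hV, lyapunov]
    fun_prop
  have hVd := fun t ht => hasDerivWithinAt_lyapunov (d * σ) e (hu t ht) (hp t ht) (hv t ht)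
    (hy t ht) (hr t ht) (hz t ht) (hfv t) (hfz t) (hgv t) (hgz t) (hfu t) (hgy t)
  intro t ht
  have hdecay := le_gronwallBound_of_liminf_deriv_right_le (f := V) (δ := V 0) (K := -m) (ε := 0)
    (a := 0) (b := t) hVc.continuousOn
    (fun x hx _ hr => by
      exact (hVd x hx.1).liminf_right_slope_le hr) le_rfl
    (fun x hx => by
      have h1 := (hw ‖p x‖ ‖v x‖ ‖r x‖ ‖z x‖).2
      have b1 : -(σ * ⟪v x, z x⟫_ℝ) ≤ ‖v x‖ * ‖z x‖ := by
        refine (neg_le_abs _).trans ?_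
        rw [abs_mul, hσ1, one_mul]
        exact abs_real_inner_le_norm _ _
      have b2 : -⟪u x, v x⟫_ℝ ≤ k * (‖p x‖ * ‖v x‖) := by
        rw [← mul_assoc]
        exact (neg_le_abs _).trans ((abs_real_inner_le_norm _ _).trans (by gcongr; exact hku x))
      have b3 : -(α * ⟪u x, z x⟫_ℝ) ≤ |α| * k * (‖p x‖ * ‖z x‖) := by
        refine (neg_le_abs _).trans ?_
        rw [abs_mul, mul_assoc, ← mul_assoc k]
        gcongr
        exact (abs_real_inner_le_norm _ _).trans (by gcongr; exact hku x)
      have b4 : α * ⟪y x, v x⟫_ℝ ≤ |α| * k * (‖r x‖ * ‖v x‖) := by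
        refine (le_abs_self _).trans ?_
        rw [abs_mul, mul_assoc, ← mul_assoc k]
        gcongr
        exact (abs_real_inner_le_norm _ _).trans (by gcongr; exact hky x)
      have b5 : V x ≤ N x := by
        have := (abs_le.1 (hVN x)).2
        have : 0 ≤ N x := by positivity
        linarith
      calc _ = -‖v x‖ ^ 2
            + d * (-(σ * ⟪v x, z x⟫_ℝ) - (σ * α) * ‖z x‖ ^ 2 + (σ * α) * ‖v x‖ ^ 2)
            + e * (‖v x‖ ^ 2 - ‖p x‖ ^ 2 + -⟪u x, v x⟫_ℝ + -(α * ⟪u x, z x⟫_ℝ)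
              + ‖z x‖ ^ 2 - ‖r x‖ ^ 2 + α * ⟪y x, v x⟫_ℝ) := by ring
        _ ≤ -‖v x‖ ^ 2 + d * (‖v x‖ * ‖z x‖ - |α| * ‖z x‖ ^ 2 + |α| * ‖v x‖ ^ 2)
            + e * (‖v x‖ ^ 2 - ‖p x‖ ^ 2 + k * (‖p x‖ * ‖v x‖) + |α| * k * (‖p x‖ * ‖z x‖)
              + ‖z x‖ ^ 2 - ‖r x‖ ^ 2 + |α| * k * (‖r x‖ * ‖v x‖)) := by
            rw [hσα]
            gcongr
        _ ≤ -m * N x := h1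
        _ ≤ -m * V x + 0 := by nlinarith) t ⟨ht, le_rfl⟩
  rw [gronwallBound_ε0, sub_zero] at hdecay
  have h0 := (abs_le.1 (hVN 0)).2
  have ht' := (abs_le.1 (hVN t)).1
  have hN0 : 0 ≤ N 0 := by positivity
  have hexp := Real.exp_pos (-m * t)
  calc N t ≤ 4 * V t := by linarith
    _ ≤ 4 * (V 0 * Real.exp (-m * t)) := by gcongr
    _ ≤ 4 * (N 0 * Real.exp (-m * t)) := by gcongr; linarith
    _ = _ := by ring

end Lyapunov

/-! ### Trajectories of a contraction semigroup -/

section Trajectories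

variable {𝕜 X : Type*} [RCLike 𝕜] [SeminormedAddCommGroup X] [NormedSpace 𝕜 X]
  (S : ContractionC0Semigroup 𝕜 X)

theorem ContractionC0Semigroup.norm_op_sub_op_le (s t : ℝ≥0) (x : X) :
    ‖S.op s x - S.op t x‖ ≤ ‖S.op (nndist s t) x - x‖ := by
  wlog h : t ≤ s generalizing s t
  · rw [norm_sub_rev, nndist_comm]
    exact this t s (le_of_not_ge h)
  have hst : nndist s t = s - t := by
    rw [NNReal.nndist_eq, tsub_eq_zero_of_le h]
    exact max_eq_left zero_le
  have : S.op s x - S.op t x = S.op t (S.op (s - t) x - x) := by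
    rw [map_sub, ← ContinuousLinearMap.comp_apply, ← S.op_add, add_tsub_cancel_of_le h]
  rw [this, hst]
  exact S.norm_op_le _ _

theorem ContractionC0Semigroup.continuous_op (x : X) : Continuous fun t => S.op t x := by
  have h0 : Tendsto (fun t : ℝ≥0 => ‖S.op t x - x‖) (𝓝 0) (𝓝 0) := by
    have h : ContinuousWithinAt (fun t : ℝ≥0 => ‖S.op t x - x‖) (Set.Ioi 0) 0 := by
      simpa [ContinuousWithinAt, S.op_zero] using ((S.tendsto_zero x).sub_const x).norm
    have h' := continuousWithinAt_Ioi_iff_Ici.1 h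
    rw [show Set.Ici (0 : ℝ≥0) = Set.univ from Set.Ici_bot, continuousWithinAt_univ] at h'
    simpa [ContinuousAt, S.op_zero] using h'
  refine continuous_iff_continuousAt.2 fun t => ?_
  rw [ContinuousAt, tendsto_iff_norm_sub_tendsto_zero]
  refine squeeze_zero (fun _ => norm_nonneg _) (fun s => S.norm_op_sub_op_le s t x) ?_
  refine h0.comp ?_
  exact (continuous_id.nndist continuous_const).tendsto' t 0 (nndist_self t)

variable {S} {B : X →ₗ.[𝕜] X}

theorem ContractionC0Semigroup.IsGeneratedBy.apply_op (hS : S.IsGeneratedBy B) (x : B.domain)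
    (t : ℝ≥0) : ∃ h : S.op t x ∈ B.domain, B ⟨S.op t x, h⟩ = S.op t (B x) := by
  refine (hS _ _).2 ?_
  have h := ((S.op t).continuous.tendsto _).comp ((hS x (B x)).1 ⟨x.2, rfl⟩)
  refine h.congr fun s => ?_
  simp only [Function.comp, map_smul, map_sub]
  rw [← ContinuousLinearMap.comp_apply, ← ContinuousLinearMap.comp_apply, ← S.op_add, ← S.op_add,
    add_comm]

/-- Trajectories starting in the domain of the generator are right differentiable. The derivative is
taken after a continuous linear map `π` into a normed space, which avoids real scalars on `X`. -/
theorem ContractionC0Semigroup.IsGeneratedBy.hasDerivWithinAt_op (hS : S.IsGeneratedBy B)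
    {F : Type*} [NormedAddCommGroup F] [NormedSpace 𝕜 F] [NormedSpace ℝ F] [IsScalarTower ℝ 𝕜 F]
    (π : X →L[𝕜] F) (x : B.domain) {t : ℝ} (ht : 0 ≤ t) {w : X}
    (hw : ∃ h : S.op t.toNNReal x ∈ B.domain, B ⟨S.op t.toNNReal x, h⟩ = w) :
    HasDerivWithinAt (fun s : ℝ => π (S.op s.toNNReal x)) (π w) (Set.Ici t) t := by
  rw [← hasDerivWithinAt_Ioi_iff_Ici, hasDerivWithinAt_iff_tendsto_slope' (by simp)]
  have h1 := (π.continuous.tendsto _).comp ((hS _ w).1 hw)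
  have h2 : Tendsto (fun s : ℝ => (s - t).toNNReal) (𝓝[>] t) (𝓝[>] 0) := by
    refine tendsto_nhdsWithin_iff.2 ⟨?_, ?_⟩
    · refine Tendsto.mono_left ?_ nhdsWithin_le_nhds
      exact (by fun_prop : Continuous fun s : ℝ => (s - t).toNNReal).tendsto' t 0 (by simp)
    · filter_upwards [self_mem_nhdsWithin] with s hs
      exact Real.toNNReal_pos.2 (sub_pos.2 hs)
  refine (h1.comp h2).congr' ?_
  filter_upwards [self_mem_nhdsWithin] with s hs
  have hst : t ≤ s := le_of_lt hs
  have h3 : S.op (s - t).toNNReal (S.op t.toNNReal x) = S.op s.toNNReal x := by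
    rw [← ContinuousLinearMap.comp_apply, ← S.op_add, ← Real.toNNReal_add (by linarith) ht,
      sub_add_cancel]
  simp only [Function.comp, slope, vsub_eq_sub, map_smul, h3, map_sub,
    Real.coe_toNNReal _ (sub_nonneg.2 hst)]
  exact (RCLike.real_smul_eq_coe_smul (K := 𝕜) _ _).symm

end Trajectories

/-! ### Exponential stability of the coupled system -/

section Stability

variable {𝕜 H ι : Type*} [RCLike 𝕜] [NormedAddCommGroup H] [InnerProductSpace 𝕜 H] [CompleteSpace H]
  {A : H →ₗ.[𝕜] H} {b : HilbertBasis ι 𝕜 H} {l : ι → ℝ}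

theorem inner_apply_eq_inner_sqrtOp (hA : IsSelfAdjoint A) (hb : ∀ i, IsEigenpair A (l i) (b i))
    (hl : ∀ i, 0 ≤ l i) (u v : (sqrtOp A).domain) (hu : (u : H) ∈ A.domain) :
    ⟪A ⟨u, hu⟩, (v : H)⟫_𝕜 = ⟪sqrtOp A u, sqrtOp A v⟫_𝕜 := by
  rw [← b.tsum_inner_mul_inner, ← b.tsum_inner_mul_inner (sqrtOp A u)]
  refine tsum_congr fun i => ?_
  rw [← inner_conj_symm, hA.inner_eigenvector_apply (hb i), ← inner_conj_symm (sqrtOp A u),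
    inner_sqrtOp_apply hA hb, inner_sqrtOp_apply hA hb, map_mul, map_mul, RCLike.conj_ofReal,
    RCLike.conj_ofReal]
  nth_rewrite 1 [← Real.mul_self_sqrt (hl i)]
  rw [RCLike.ofReal_mul]
  ring

theorem norm_le_norm_sqrtOp (hA : IsSelfAdjoint A) (hb : ∀ i, IsEigenpair A (l i) (b i)) {c : ℝ}
    (hc : 0 < c) (hl : ∀ i, c ≤ l i) (u : (sqrtOp A).domain) :
    ‖(u : H)‖ ≤ (√c)⁻¹ * ‖sqrtOp A u‖ := by
  have h : c * ‖(u : H)‖ ^ 2 ≤ ‖sqrtOp A u‖ ^ 2 := by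
    refine hasSum_le (fun i => ?_) ((b.hasSum_norm_inner_sq (u : H)).mul_left c)
      (b.hasSum_norm_inner_sq _)
    rw [inner_sqrtOp_apply hA hb, norm_mul, mul_pow, RCLike.norm_ofReal, sq_abs,
      Real.sq_sqrt (hc.le.trans (hl i))]
    gcongr
    exact hl i
  rw [← div_eq_inv_mul, le_div_iff₀ (Real.sqrt_pos.2 hc)]
  refine (sq_le_sq₀ (by positivity) (norm_nonneg _)).1 ?_
  rwa [mul_pow, Real.sq_sqrt hc.le, mul_comm]

/-- The components of the image in the Hilbert sum, as continuous maps on the energy space. -/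
noncomputable def EnergySpace.component (A : H →ₗ.[𝕜] H) (k : Fin 4) : EnergySpace A →L[𝕜] H :=
  LinearMap.mkContinuous
    { toFun := fun U => EnergySpace.toHilbertSum A U k
      map_add' := fun U W => by rw [map_add]; rfl
      map_smul' := fun c U => by rw [map_smul]; rfl } 1 fun U => by
    rw [one_mul]
    exact PiLp.norm_apply_le (EnergySpace.toHilbertSum A U) k

theorem isExponentiallyStable_of_isGeneratedBy_coupledOperator (hA : IsSelfAdjoint A)
    (hb : ∀ i, IsEigenpair A (l i) (b i)) {c : ℝ} (hc : 0 < c) (hl : ∀ i, c ≤ l i) {α : ℝ}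
    (hα : α ≠ 0) {S : ContractionC0Semigroup 𝕜 (EnergySpace A)}
    (hS : S.IsGeneratedBy (coupledOperator A α)) : S.IsExponentiallyStable := by
  let _ : InnerProductSpace ℝ H := InnerProductSpace.rclikeToReal 𝕜 H
  have hk : 0 < (√c)⁻¹ := by positivity
  have hbound := norm_le_norm_sqrtOp hA hb hc hl
  have hl0 : ∀ i, 0 ≤ l i := fun i => hc.le.trans (hl i)
  let πu : EnergySpace A →L[𝕜] H := LinearMap.mkContinuous
    { toFun := fun U => (U.u : H)
      map_add' := fun _ _ => rfl
      map_smul' := fun _ _ => rfl } (√c)⁻¹ fun U => (hbound U.u).trans (by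
        gcongr
        exact PiLp.norm_apply_le (EnergySpace.toHilbertSum A U) 0)
  let πy : EnergySpace A →L[𝕜] H := LinearMap.mkContinuous
    { toFun := fun U => (U.y : H)
      map_add' := fun _ _ => rfl
      map_smul' := fun _ _ => rfl } (√c)⁻¹ fun U => (hbound U.y).trans (by
        gcongr
        exact PiLp.norm_apply_le (EnergySpace.toHilbertSum A U) 2)
  obtain ⟨m, hm, hdecay⟩ := exists_energy_decay_rate hα hk
  refine ⟨2, m / 2, two_pos, half_pos hm, fun t _ U => ?_⟩
  have hdom : ∀ U ∈ (coupledOperator A α).domain,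
      ‖S.op t U‖ ≤ 2 * Real.exp (-(m / 2) * t) * ‖U‖ := by
    intro U hU
    let T : ℝ → EnergySpace A := fun s => S.op s.toNNReal U
    have hT : ∀ s, T s ∈ (coupledOperator A α).domain := fun s =>
      (hS.apply_op ⟨U, hU⟩ s.toNNReal).1
    have hTc : Continuous T := (S.continuous_op U).comp continuous_real_toNNReal
    have hTd : ∀ (π : EnergySpace A →L[𝕜] H) (s : ℝ), 0 ≤ s → HasDerivWithinAt
        (fun s => π (T s)) (π (coupledOperator A α ⟨T s, hT s⟩)) (Set.Ici s) s := fun π s hs =>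
      hS.hasDerivWithinAt_op π ⟨U, hU⟩ hs ⟨hT s, rfl⟩
    have hsq : ∀ (w u : (sqrtOp A).domain) (h : (u : H) ∈ A.domain),
        ⟪A ⟨u, h⟩, (w : H)⟫_ℝ = ⟪sqrtOp A u, sqrtOp A w⟫_ℝ := fun w u h =>
      congrArg RCLike.re (inner_apply_eq_inner_sqrtOp hA hb hl0 u w h)
    have key := hdecay (G := H) (u := fun s => πu (T s))
      (p := fun s => EnergySpace.component A 0 (T s))
      (v := fun s => EnergySpace.component A 1 (T s)) (y := fun s => πy (T s))
      (r := fun s => EnergySpace.component A 2 (T s))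
      (z := fun s => EnergySpace.component A 3 (T s))
      (f := fun s => A ⟨(T s).u, (hT s).1⟩) (g := fun s => A ⟨(T s).y, (hT s).2.2.1⟩)
      (p' := fun s => sqrtOp A ⟨(T s).v, (hT s).2.1⟩)
      (r' := fun s => sqrtOp A ⟨(T s).z, (hT s).2.2.2⟩)
      (πu.continuous.comp hTc) ((EnergySpace.component A 0).continuous.comp hTc)
      ((EnergySpace.component A 1).continuous.comp hTc) (πy.continuous.comp hTc)
      ((EnergySpace.component A 2).continuous.comp hTc)
      ((EnergySpace.component A 3).continuous.comp hTc)
      (hTd πu) (hTd _)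
      (fun s hs => (hTd (EnergySpace.component A 1) s hs).congr_deriv (by
        rw [RCLike.real_smul_eq_coe_smul (K := 𝕜)]; rfl))
      (hTd πy) (hTd _)
      (fun s hs => (hTd (EnergySpace.component A 3) s hs).congr_deriv (by
        rw [RCLike.real_smul_eq_coe_smul (K := 𝕜)]; rfl))
      (fun s => hsq ⟨(T s).v, (hT s).2.1⟩ (T s).u _)
      (fun s => hsq ⟨(T s).z, (hT s).2.2.2⟩ (T s).u _)
      (fun s => hsq ⟨(T s).v, (hT s).2.1⟩ (T s).y _)
      (fun s => hsq ⟨(T s).z, (hT s).2.2.2⟩ (T s).y _)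
      (fun s => (hsq (T s).u (T s).u _).trans (real_inner_self_eq_norm_sq _))
      (fun s => (hsq (T s).y (T s).y _).trans (real_inner_self_eq_norm_sq _))
      (fun s => hbound (T s).u) (fun s => hbound (T s).y) t t.2
    have hT0 : T 0 = U := by simp [T, S.op_zero]
    have hTt : T t = S.op t U := by simp [T]
    have e : ∀ s, ‖EnergySpace.component A 0 (T s)‖ ^ 2 + ‖EnergySpace.component A 1 (T s)‖ ^ 2
        + ‖EnergySpace.component A 2 (T s)‖ ^ 2 + ‖EnergySpace.component A 3 (T s)‖ ^ 2
          = ‖T s‖ ^ 2 :=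
      fun s => (EnergySpace.norm_sq A (T s)).symm
    rw [e, e, hT0, hTt] at key
    refine (sq_le_sq₀ (norm_nonneg _) (by positivity)).1 (key.trans_eq ?_)
    rw [mul_pow, mul_pow, ← Real.exp_nat_mul]
    push_cast
    ring_nf
  have hclosed : IsClosed {U : EnergySpace A | ‖S.op t U‖ ≤ 2 * Real.exp (-(m / 2) * t) * ‖U‖} :=
    isClosed_le (by fun_prop) (by fun_prop)
  exact hclosed.closure_subset_iff.2 hdom (coupledOperator_dense_domain hA hb hc hl α U)

end Stability

theorem mainTheorem1 {𝕜 H : Type*} [RCLike 𝕜] [NormedAddCommGroup H] [InnerProductSpace 𝕜 H]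
    [CompleteSpace H] [TopologicalSpace.SeparableSpace H]
    (A : H →ₗ.[𝕜] H) (hA_selfAdjoint : IsSelfAdjoint A) (hA_coercive : IsCoerciveOperator A)
    (hA_compact : HasCompactResolvent A) (hA_simple : HasSimpleSpectrum A)
    (α : ℝ) (hα : α ≠ 0) :
    (∃ S : ContractionC0Semigroup 𝕜 (EnergySpace A), S.IsGeneratedBy (coupledOperator A α)) ∧
    (∀ S : ContractionC0Semigroup 𝕜 (EnergySpace A), S.IsGeneratedBy (coupledOperator A α) →
      S.IsExponentiallyStable) := by
  obtain ⟨ι, b, l, c, hc, hl, hb⟩ :=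
    exists_hilbertBasis_isEigenpair hA_selfAdjoint hA_coercive hA_compact hA_simple
  exact ⟨exists_isGeneratedBy_coupledOperator hA_selfAdjoint hb hc hl α, fun S hS =>
    isExponentiallyStable_of_isGeneratedBy_coupledOperator hA_selfAdjoint hb hc hl hα hS⟩
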